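/- All groups are finite, and all classes of groups are non-empty and closed under isomorphism. Let $\pi$ be a set of primes and $\pi'$ its complement in the set of all primes. A *formation* is a class of groups closed under homomorphic images and subdirect products; for a formation $\mathfrak F$, $G^{\mathfrak F}$ denotes the smallest normal subgroup $N$ of $G$ with $G/N\in\mathfrak F$, and for a class $\mathfrak X$, $\mathfrak X\circ\mathfrak F$ is the class of all groups $G$ with $G^{\mathfrak F}\in\mathfrak X$. Let $\mathfrak N$ be the class of nilpotent groups; $\mathfrak G_\pi$ the class of $\pi$-groups, with $\mathfrak G_p=\mathfrak G_{\{p\}}$; $\mathfrak N_\pi$ the class of $\pi$-nilpotent groups (groups with a normal $\pi'$-subgroup whose quotient is nilpotent); and $\mathfrak S_\pi$ the class of $\pi$-solvable groups (groups each of whose chief factors is a $p$-group for some $p\in\pi$ or a $\pi'$-group). Let $\mathrm{Crit}_{\mathtt S}(\mathfrak X)$ be the class of all groups $G\notin\mathfrak X$ all of whose proper subgroups belong to $\mathfrak X$. A formation $\mathfrak F$ satisfies the *$\pi$-boundary condition (I)* if $\mathrm{Crit}_{\mathtt S}(\mathfrak F)\subseteq\mathfrak N_\pi\circ\mathfrak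 F$, and the *$\pi$-boundary condition (II)* if $\mathrm{Crit}_{\mathtt S}(\mathfrak G_p\circ\mathfrak F)\subseteq\mathfrak S_\pi\circ\mathfrak F$ for every $p\in\pi$. The *$\pi'\mathfrak F$-norm* of $G$ is $\mathcal N_{\pi'\mathfrak F}(G)=\bigcap_{H\le G}N_G\bigl(H^{\mathfrak F}O_{\pi'}(G)\bigr)$, where $O_{\pi'}(G)$ is the largest normal $\pi'$-subgroup of $G$. Put $\mathcal N^0_{\pi'\mathfrak F}(G)=1$ and $\mathcal N^{i}_{\pi'\mathfrak F}(G)/\mathcal N^{i-1}_{\pi'\mathfrak F}(G)=\mathcal N_{\pi'\mathfrak F}\bigl(G/\mathcal N^{i-1}_{\pi'\mathfrak F}(G)\bigr)$ for $i\ge 1$, and let $\mathcal N^\infty_{\pi'\mathfrak F}(G)$ be the terminal term of this ascending series. For a formation $\mathfrak B$, a chief factor $L/K$ of $G$ is *$\mathfrak B$-central* in $G$ if $(L/K)\rtimes(G/C_G(L/K))\in\mathfrak B$; the *$\pi\mathfrak B$-hypercentre* $Z_{\pi\mathfrak B}(G)$ is the product of all normal subgroups $N$ of $G$ such that every chief factor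 of $G$ below $N$ of order divisible by at least one prime in $\pi$ is $\mathfrak B$-central in $G$. **Theorem.** Let $\mathfrak F$ be a formation that is closed under taking subgroups. Then: (1) If $\mathfrak F$ satisfies the $\pi$-boundary condition (II), then $\mathcal N^\infty_{\pi'\mathfrak F}(G)=Z_{\pi(\mathfrak N\circ\mathfrak F)}(G)$ for every group $G$. (2) If $\mathcal N^\infty_{\pi'\mathfrak F}(G)=Z_{\pi(\mathfrak N\circ\mathfrak F)}(G)$ for every group $G$, then $\mathfrak F$ satisfies the $\pi$-boundary condition (I). (3) $\mathcal N^\infty_{\pi'\mathfrak F}(G)=Z_{\pi(\mathfrak N\circ\mathfrak F)}(G)$ holds for every group $G$ if and only if it holds for every group $G\in\bigcup_{p\in\pi}\bigl(\mathrm{Crit}_{\mathtt S}(\mathfrak G_p\circ\mathfrak F)\setminus(\mathfrak S_\pi\circ\mathfrak F)\bigr)$. -/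

import Mathlib

universe u

/-- A class of finite groups: a property of groups, closed under isomorphism, whose members are
finite. -/
structure GroupClass where
  Mem : ∀ (G : Type u) [Group G], Prop
  finite : ∀ {G : Type u} [Group G], Mem G → Finite G
  iso : ∀ {G H : Type u} [Group G] [Group H], G ≃* H → Mem G → Mem H

namespace GroupClass

/-- A formation: a nonempty class closed under homomorphic images and subdirect products. -/
structure IsFormation (F : GroupClass.{u}) : Prop where
  nonempty : ∃ (G : Type u) (_ : Group G), F.Mem G
  image : ∀ {G H : Type u} [Group G] [Group H] (f : G →* H),
    Function.Surjective f → F.Mem G → F.Mem H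
  subdirect : ∀ {G A B : Type u} [Group G] [Group A] [Group B] (f : G →* A) (g : G →* B),
    Function.Surjective f → Function.Surjective g → Function.Injective (f.prod g) →
    F.Mem A → F.Mem B → F.Mem G

/-- `F` is closed under taking subgroups. -/
def IsSubgroupClosed (F : GroupClass.{u}) : Prop :=
  ∀ {G : Type u} [Group G] (H : Subgroup G), F.Mem G → F.Mem H

/-- The `F`-residual of `G`: the intersection of all normal subgroups `N` with `G ⧸ N ∈ F`.
If `F` is a formation and `G` is finite, it is the smallest such `N`. -/
def residual (F : GroupClass.{u}) (G : Type u) [Group G] : Subgroup G :=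
  sInf {N : Subgroup G | ∃ _ : N.Normal, F.Mem (G ⧸ N)}

/-- The `X`-radical of `G`: the product of all normal subgroups of `G` that belong to `X`. -/
def radical (X : GroupClass.{u}) (G : Type u) [Group G] : Subgroup G :=
  sSup {N : Subgroup G | N.Normal ∧ X.Mem N}

theorem residual_map_le (F : GroupClass.{u}) {G H : Type u} [Group G] [Group H] (e : G ≃* H) :
    (F.residual G).map (e : G →* H) ≤ F.residual H := by
  refine le_sInf ?_
  rintro N ⟨hN, hF⟩
  rw [Subgroup.map_le_iff_le_comap]
  refine sInf_le ⟨hN.comap _, ?_⟩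
  have hmap : (N.comap (e : G →* H)).map (e : G →* H) = N :=
    Subgroup.map_comap_eq_self_of_surjective e.surjective N
  exact F.iso (QuotientGroup.congr (N.comap (e : G →* H)) N e hmap).symm hF

theorem residual_map (F : GroupClass.{u}) {G H : Type u} [Group G] [Group H] (e : G ≃* H) :
    (F.residual G).map (e : G →* H) = F.residual H := by
  refine le_antisymm (F.residual_map_le e) ?_
  intro x hx
  exact ⟨e.symm x, F.residual_map_le e.symm ⟨x, hx, rfl⟩, e.apply_symm_apply x⟩

theorem radical_map_le (X : GroupClass.{u}) {G H : Type u} [Group G] [Group H] (e : G ≃* H) :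
    (X.radical G).map (e : G →* H) ≤ X.radical H := by
  rw [Subgroup.map_le_iff_le_comap]
  refine sSup_le ?_
  rintro N ⟨hN, hX⟩
  rw [← Subgroup.map_le_iff_le_comap]
  exact le_sSup ⟨hN.map _ e.surjective, X.iso (e.subgroupMap N) hX⟩

/-- The formation product `X ∘ F`: the finite groups whose `F`-residual belongs to `X`. -/
def prod (X F : GroupClass.{u}) : GroupClass.{u} where
  Mem G _ := Finite G ∧ X.Mem (F.residual G)
  finite h := h.1
  iso := by
    intro G H _ _ e h
    have := h.1
    refine ⟨Finite.of_equiv G e.toEquiv, ?_⟩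
    exact X.iso ((e.subgroupMap (F.residual G)).trans
      (MulEquiv.subgroupCongr (F.residual_map e))) h.2

/-- The class of finite nilpotent groups. -/
def nilpotentGroups : GroupClass.{u} where
  Mem G _ := Finite G ∧ Group.IsNilpotent G
  finite h := h.1
  iso := by
    intro G H _ _ e h
    have := h.1
    have := h.2
    exact ⟨Finite.of_equiv G e.toEquiv, Group.nilpotent_of_mulEquiv e⟩

/-- The class of finite `π`-groups. -/
def piGroups (π : Set Nat.Primes) : GroupClass.{u} where
  Mem G _ := Finite G ∧ ∀ p : Nat.Primes, (p : ℕ) ∣ Nat.card G → p ∈ π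
  finite h := h.1
  iso := by
    intro G H _ _ e h
    have := h.1
    refine ⟨Finite.of_equiv G e.toEquiv, ?_⟩
    rw [← Nat.card_congr e.toEquiv]
    exact h.2

/-- The class of finite `π`-nilpotent groups: finite groups with a normal `π'`-subgroup whose
quotient is nilpotent. -/
def piNilpotentGroups (π : Set Nat.Primes) : GroupClass.{u} where
  Mem G _ := Finite G ∧
    ∃ (N : Subgroup G) (_ : N.Normal), (piGroups πᶜ).Mem N ∧ Group.IsNilpotent (G ⧸ N)
  finite h := h.1
  iso := by
    rintro G H _ _ e ⟨hG, N, hN, h1, h2⟩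
    have hN' : (N.map (e : G →* H)).Normal := hN.map _ e.surjective
    exact ⟨Finite.of_equiv G e.toEquiv, N.map (e : G →* H), hN',
      (piGroups πᶜ).iso (e.subgroupMap N) h1,
      Group.nilpotent_of_mulEquiv (QuotientGroup.congr N (N.map (e : G →* H)) e rfl)⟩

end GroupClass

/-- `L / K` is a chief factor of `G`. -/
structure IsChiefFactor {G : Type u} [Group G] (K L : Subgroup G) : Prop where
  normal_bot : K.Normal
  normal_top : L.Normal
  lt : K < L
  eq_or_eq : ∀ M : Subgroup G, M.Normal → K ≤ M → M ≤ L → M = K ∨ M = L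

theorem IsChiefFactor.comap {G H : Type u} [Group G] [Group H] (e : G ≃* H) {K L : Subgroup H}
    (h : IsChiefFactor K L) : IsChiefFactor (K.comap (e : G →* H)) (L.comap (e : G →* H)) where
  normal_bot := h.normal_bot.comap _
  normal_top := h.normal_top.comap _
  lt := (Subgroup.comap_lt_comap_of_surjective e.surjective).2 h.lt
  eq_or_eq := by
    intro M hM hKM hML
    have hs : Function.Surjective (e : G →* H) := e.surjective
    have hcm : (M.map (e : G →* H)).comap (e : G →* H) = M :=
      Subgroup.comap_map_eq_self_of_injective e.injective M
    rcases h.eq_or_eq (M.map (e : G →* H)) (hM.map _ hs)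
      ((Subgroup.comap_le_comap_of_surjective hs).1 (hcm.symm ▸ hKM))
      (Subgroup.map_le_iff_le_comap.2 hML) with h1 | h1
    · left; rw [← h1, hcm]
    · right; rw [← h1, hcm]

namespace GroupClass

/-- The class of finite `π`-solvable groups: every chief factor is either a `p`-group for some
`p ∈ π` or a `π'`-group. -/
def piSolvableGroups (π : Set Nat.Primes) : GroupClass.{u} where
  Mem G _ := Finite G ∧ ∀ K L : Subgroup G, IsChiefFactor K L →
    (∃ p ∈ π, ∃ n : ℕ, K.relIndex L = (p : ℕ) ^ n) ∨ ∀ p ∈ π, ¬ (p : ℕ) ∣ K.relIndex L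
  finite h := h.1
  iso := by
    rintro G H _ _ e ⟨hG, h⟩
    refine ⟨Finite.of_equiv G e.toEquiv, fun K L hKL => ?_⟩
    have := h _ _ (hKL.comap e)
    rwa [Subgroup.relIndex_comap,
      Subgroup.map_comap_eq_self_of_surjective e.surjective] at this

/-- `G` is `S`-critical for `X`: `G` is a finite group outside `X` all of whose proper subgroups
belong to `X`. -/
def IsCritical (X : GroupClass.{u}) (G : Type u) [Group G] : Prop :=
  Finite G ∧ ¬ X.Mem G ∧ ∀ H : Subgroup G, H < ⊤ → X.Mem H

/-- The `π`-boundary condition (I): `Crit_S(F) ⊆ N_π ∘ F`. -/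
def BoundaryConditionI (π : Set Nat.Primes) (F : GroupClass.{u}) : Prop :=
  ∀ (G : Type u) [Group G], F.IsCritical G → ((piNilpotentGroups π).prod F).Mem G

/-- The `π`-boundary condition (II): `Crit_S(G_p ∘ F) ⊆ S_π ∘ F` for every `p ∈ π`. -/
def BoundaryConditionII (π : Set Nat.Primes) (F : GroupClass.{u}) : Prop :=
  ∀ p ∈ π, ∀ (G : Type u) [Group G],
    ((piGroups {p}).prod F).IsCritical G → ((piSolvableGroups π).prod F).Mem G

/-- The `X`-`F`-norm of `G`: the intersection over all subgroups `H` of `G` of the normalizers of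
the products of the `F`-residual of `H` with the (normal) `X`-radical of `G`. -/
def norm (X F : GroupClass.{u}) (G : Type u) [Group G] : Subgroup G :=
  ⨅ H : Subgroup G,
    Subgroup.normalizer (((F.residual H).map H.subtype ⊔ X.radical G : Subgroup G) : Set G)

theorem norm_map_le (X F : GroupClass.{u}) {G : Type u} [Group G] (e : G ≃* G) :
    (X.norm F G).map (e : G →* G) ≤ X.norm F G := by
  have key : ∀ H : Subgroup G,
      ((F.residual H).map H.subtype ⊔ X.radical G).map (e : G →* G) =
        (F.residual (H.map (e : G →* G))).map (H.map (e : G →* G)).subtype ⊔ X.radical G := by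
    intro H
    rw [Subgroup.map_sup]
    congr 1
    · have h := F.residual_map (e.subgroupMap H)
      calc ((F.residual H).map H.subtype).map (e : G →* G)
          = ((F.residual H).map (e.subgroupMap H : H →* H.map (e : G →* G))).map
              (H.map (e : G →* G)).subtype := by
            rw [Subgroup.map_map, Subgroup.map_map]; rfl
        _ = _ := congrArg _ h
    · refine le_antisymm (X.radical_map_le e) fun x hx => ?_
      exact ⟨e.symm x, X.radical_map_le e.symm ⟨x, hx, rfl⟩, e.apply_symm_apply x⟩
  refine le_iInf fun H => ?_
  have hH : (H.comap (e : G →* G)).map (e : G →* G) = H :=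
    Subgroup.map_comap_eq_self_of_surjective e.surjective H
  have h1 := key (H.comap (e : G →* G))
  rw [hH] at h1
  rw [← h1]
  exact (Subgroup.map_mono (iInf_le _ (H.comap (e : G →* G)))).trans
    (Subgroup.le_normalizer_map _)

instance norm_normal (X F : GroupClass.{u}) (G : Type u) [Group G] : (X.norm F G).Normal :=
  ⟨fun n hn g => X.norm_map_le F (MulAut.conj g) ⟨n, hn, rfl⟩⟩

/-- The `X`-`F`-norm series `N⁰ = 1`, `Nⁱ⁺¹ / Nⁱ = norm of G / Nⁱ`, bundled with normality. -/
def normSeriesAux (X F : GroupClass.{u}) (G : Type u) [Group G] :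
    ℕ → {N : Subgroup G // N.Normal}
  | 0 => ⟨⊥, inferInstance⟩
  | i + 1 =>
    let N := normSeriesAux X F G i
    haveI : N.1.Normal := N.2
    ⟨(X.norm F (G ⧸ N.1)).comap (QuotientGroup.mk' N.1), inferInstance⟩

/-- The `i`-th term of the `X`-`F`-norm series of `G`. -/
def normSeries (X F : GroupClass.{u}) (G : Type u) [Group G] (i : ℕ) : Subgroup G :=
  (normSeriesAux X F G i).1

/-- The terminal term of the `X`-`F`-norm series. The series is ascending, so for a finite group
it becomes stationary and its supremum is its terminal term. -/
def normInfty (X F : GroupClass.{u}) (G : Type u) [Group G] : Subgroup G :=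
  ⨆ i : ℕ, X.normSeries F G i

end GroupClass

/-- The action of `G` by conjugation on `L / K`, where `L / K` is the image of `L` in `G ⧸ K`
(for `K ≤ L`). Its kernel is the centralizer `C_G(L / K)`. -/
def factorAction {G : Type u} [Group G] (K L : Subgroup G) [K.Normal] [L.Normal] :
    G →* MulAut (L.map (QuotientGroup.mk' K)) :=
  haveI : (L.map (QuotientGroup.mk' K)).Normal :=
    Subgroup.Normal.map ‹_› _ (QuotientGroup.mk'_surjective K)
  MulAut.conjNormal.comp (QuotientGroup.mk' K)

namespace GroupClass

/-- The factor `L / K` is `F`-central in `G`: `(L / K) ⋊ (G / C_G(L / K)) ∈ F`. -/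
def IsCentralFactor (F : GroupClass.{u}) {G : Type u} [Group G] (K L : Subgroup G)
    [K.Normal] [L.Normal] : Prop :=
  F.Mem (L.map (QuotientGroup.mk' K) ⋊[QuotientGroup.kerLift (factorAction K L)]
    (G ⧸ (factorAction K L).ker))

/-- The normal subgroup `N` is `πF`-hypercentral in `G`: every chief factor of `G` below `N` of
order divisible by some prime in `π` is `F`-central in `G` (no condition if `N = 1`). -/
def IsHypercentral (π : Set Nat.Primes) (F : GroupClass.{u}) {G : Type u} [Group G]
    (N : Subgroup G) : Prop :=
  N.Normal ∧ ∀ (K L : Subgroup G) [K.Normal] [L.Normal], IsChiefFactor K L → L ≤ N →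
    (∃ p ∈ π, (p : ℕ) ∣ K.relIndex L) → F.IsCentralFactor K L

/-- The `πF`-hypercentre of `G`: the product of all `πF`-hypercentral normal subgroups. -/
def hypercentre (π : Set Nat.Primes) (F : GroupClass.{u}) (G : Type u) [Group G] : Subgroup G :=
  sSup {N : Subgroup G | IsHypercentral π F N}

/-- The equality of the terminal term of the `π'F`-norm series of `G` with the
`π(N ∘ F)`-hypercentre of `G`. -/
def NormEqHypercentre (π : Set Nat.Primes) (F : GroupClass.{u}) (G : Type u) [Group G] : Prop :=
  (piGroups πᶜ).normInfty F G = hypercentre π (nilpotentGroups.prod F) G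

end GroupClass

/-! Write D for the F-residual of G. A chief factor is central for N ∘ F exactly when D centralizes
it (`isCentralFactor_iff`): a nilpotent normal subgroup centralizes every minimal normal subgroup.
So the hypercentre is the largest normal subgroup below which D centralizes every chief factor of
order divisible by a prime of π, a condition expressed by `CentralizesPiFactors`.

The hypercentre always lies in the terminal norm (`hypercentre_le_normInfty`): a chief factor
directly above the terminal term and inside its product with the hypercentre is either a π'-group or
centralized by the residual, hence lies in the norm of the quotient, which is trivial. For the
reverse inclusion it suffices that the norm of every group is hypercentral
(`normEqHypercentre_of_quotients`).

A smallest group G where this fails has a unique minimal normal subgroup L. It has order divisible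
by a prime of π, is not centralized by D, and normalizes the residual of every subgroup
(`exists_isMinimalConfiguration`). Such a G is critical for G_p ∘ F for some p ∈ π and lies outside
S_π ∘ F (`IsMinimalConfiguration.exists_isCritical`). If L is non-abelian, all proper subgroups of G
lie in F. If L is a p-group, its centralizer C is a p-group without proper supplements; coprime
action makes the residuals of proper subgroups p-groups, and π-solvability of D would yield a
nontrivial normal subgroup of G meeting C trivially. Hence equality for the exceptional critical
groups gives it for all groups, and under condition (II) there are no exceptional groups.

Condition (I) follows because an F-critical group equals its norm (`norm_eq_top_of_isCritical`), so
D centralizes all chief factors involving π and is π-nilpotent (`piNilpotentGroups_mem`). -/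

section ChiefFactors

/-! ### Chief factors under joins, meets and homomorphisms. -/

variable {G : Type u} [Group G]

theorem exists_isChiefFactor [Finite G] {K N : Subgroup G} (hK : K.Normal) (hN : N.Normal)
    (h : K < N) : ∃ L, IsChiefFactor K L ∧ L ≤ N := by
  obtain ⟨L, hL⟩ := (Set.toFinite {L : Subgroup G | L.Normal ∧ K < L ∧ L ≤ N}).exists_minimal
    ⟨N, hN, h, le_rfl⟩
  refine ⟨L, ⟨hK, hL.prop.1, hL.prop.2.1, fun M hM hKM hML => ?_⟩, hL.prop.2.2⟩
  rcases hKM.eq_or_lt with h1 | h1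
  · exact Or.inl h1.symm
  · exact Or.inr (le_antisymm hML (hL.le_of_le ⟨hM, h1, hML.trans hL.prop.2.2⟩ hML))

/-- Dedekind's modular law. -/
theorem inf_sup_eq_of_le_of_normal {A B C : Subgroup G} (hB : B.Normal) (h : B ≤ A) :
    A ⊓ (C ⊔ B) = (A ⊓ C) ⊔ B := by
  refine le_antisymm ?_ (sup_le (inf_le_inf_left _ le_sup_left) (le_inf h le_sup_right))
  rintro x ⟨hx, hx'⟩
  obtain ⟨c, hc, b, hb, rfl⟩ := Subgroup.mem_sup_of_normal_right.1 hx'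
  exact Subgroup.mul_mem_sup ⟨(A.mul_mem_cancel_right (h hb)).1 hx, hc⟩ hb

/-- Modulo K the hypotheses place A and B in the centralizer of D, which is a subgroup; neither A
nor B need be normal. -/
theorem commutator_sup_le {D A B K : Subgroup G} (hK : K.Normal) (hA : ⁅D, A⁆ ≤ K)
    (hB : ⁅D, B⁆ ≤ K) : ⁅D, A ⊔ B⁆ ≤ K := by
  have key : ∀ A : Subgroup G, ⁅D, A⁆ ≤ K ↔
      A ≤ (Subgroup.centralizer (D.map (QuotientGroup.mk' K) : Set (G ⧸ K))).comap
        (QuotientGroup.mk' K) := by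
    intro A
    rw [← Subgroup.map_le_iff_le_comap, ← Subgroup.commutator_eq_bot_iff_le_centralizer,
      ← Subgroup.map_commutator, Subgroup.commutator_comm, Subgroup.map_eq_bot_iff,
      QuotientGroup.ker_mk']
  rw [key] at hA hB ⊢
  exact sup_le hA hB

/-- The case where Y avoids L / K: then L / K is G-isomorphic to LY / KY. -/
theorem IsChiefFactor.sup {K L Y : Subgroup G} (h : IsChiefFactor K L) (hY : Y.Normal)
    (hKY : L ⊓ (K ⊔ Y) ≤ K) : IsChiefFactor (K ⊔ Y) (L ⊔ Y) where
  normal_bot := have := h.normal_bot; inferInstance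
  normal_top := have := h.normal_top; inferInstance
  lt := by
    refine lt_of_le_of_ne (sup_le_sup_right h.lt.le _) fun he => h.lt.not_ge ?_
    exact (le_inf le_rfl (he ▸ le_sup_left)).trans hKY
  eq_or_eq := by
    intro M hM h1 h2
    have hL := h.normal_top
    have hYM : Y ≤ M := le_sup_right.trans h1
    have hMe : M = (M ⊓ L) ⊔ Y := by
      rw [← inf_sup_eq_of_le_of_normal hY hYM, inf_eq_left.2 h2]
    rcases h.eq_or_eq (M ⊓ L) inferInstance (le_inf (le_sup_left.trans h1) h.lt.le) inf_le_right
      with h3 | h3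
    · left; rw [hMe, h3]
    · right; rw [hMe, h3]

theorem IsChiefFactor.relIndex_sup {K L Y : Subgroup G} (h : IsChiefFactor K L) (hY : Y.Normal)
    (hKY : L ⊓ (K ⊔ Y) ≤ K) : (K ⊔ Y).relIndex (L ⊔ Y) = K.relIndex L := by
  have := h.normal_bot
  have h1 : L ⊔ Y = L ⊔ (K ⊔ Y) := by
    rw [← sup_assoc, sup_eq_left.2 h.lt.le]
  have h2 : (K ⊔ Y) ⊓ L = K :=
    le_antisymm (inf_comm (K ⊔ Y) L ▸ hKY) (le_inf le_sup_left h.lt.le)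
  rw [h1, Subgroup.relIndex_sup_right, ← Subgroup.inf_relIndex_right, h2]

/-- The case where Y covers L / K: then L / K is G-isomorphic to (L ∩ Y) / (K ∩ Y). -/
theorem IsChiefFactor.inf {K L Y : Subgroup G} (h : IsChiefFactor K L) (hY : Y.Normal)
    (hLY : L ≤ (L ⊓ Y) ⊔ K) : IsChiefFactor (K ⊓ Y) (L ⊓ Y) where
  normal_bot := have := h.normal_bot; inferInstance
  normal_top := have := h.normal_top; inferInstance
  lt := by
    refine lt_of_le_of_ne (inf_le_inf_right _ h.lt.le) fun he => h.lt.not_ge ?_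
    exact hLY.trans (sup_le (he ▸ inf_le_left) le_rfl)
  eq_or_eq := by
    intro M hM h1 h2
    have hK := h.normal_bot
    have hMe : M = (M ⊔ K) ⊓ Y := by
      rw [inf_comm, sup_comm, inf_sup_eq_of_le_of_normal hM (h2.trans inf_le_right), inf_comm,
        sup_eq_right.2 h1]
    rcases h.eq_or_eq (M ⊔ K) inferInstance le_sup_right (sup_le (h2.trans inf_le_left) h.lt.le)
      with h3 | h3
    · left; rw [hMe, h3]
    · right; rw [hMe, h3]

theorem IsChiefFactor.relIndex_inf {K L Y : Subgroup G} (h : IsChiefFactor K L)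
    (hLY : L ≤ (L ⊓ Y) ⊔ K) : (K ⊓ Y).relIndex (L ⊓ Y) = K.relIndex L := by
  have := h.normal_bot
  have h1 : L = (L ⊓ Y) ⊔ K := le_antisymm hLY (sup_le inf_le_left h.lt.le)
  have h2 : K ⊓ Y = K ⊓ (L ⊓ Y) := by rw [← inf_assoc, inf_eq_left.2 h.lt.le]
  rw [h2, Subgroup.inf_relIndex_right]
  conv_rhs => rw [h1, Subgroup.relIndex_sup_right]

theorem IsChiefFactor.comap_of_surjective {H : Type u} [Group H] {f : G →* H}
    (hf : Function.Surjective f) {K L : Subgroup H} (h : IsChiefFactor K L) :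
    IsChiefFactor (K.comap f) (L.comap f) where
  normal_bot := h.normal_bot.comap _
  normal_top := h.normal_top.comap _
  lt := (Subgroup.comap_lt_comap_of_surjective hf).2 h.lt
  eq_or_eq := by
    intro M hM hKM hML
    have hcm : (M.map f).comap f = M := Subgroup.comap_map_eq_self
      ((Subgroup.comap_mono bot_le).trans hKM)
    rcases h.eq_or_eq (M.map f) (hM.map _ hf)
      ((Subgroup.comap_le_comap_of_surjective hf).1 (hcm.symm ▸ hKM))
      (Subgroup.map_le_iff_le_comap.2 hML) with h1 | h1
    · left; rw [← h1, hcm]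
    · right; rw [← h1, hcm]

theorem IsChiefFactor.map_of_surjective {H : Type u} [Group H] {f : G →* H}
    (hf : Function.Surjective f) {K L : Subgroup G} (h : IsChiefFactor K L) (hK : f.ker ≤ K) :
    IsChiefFactor (K.map f) (L.map f) where
  normal_bot := h.normal_bot.map _ hf
  normal_top := h.normal_top.map _ hf
  lt := by
    refine lt_of_le_of_ne (Subgroup.map_mono h.lt.le) fun he => h.lt.ne ?_
    rw [← Subgroup.comap_map_eq_self hK, he, Subgroup.comap_map_eq_self (hK.trans h.lt.le)]
  eq_or_eq := by
    intro M hM hKM hML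
    have hmc : (M.comap f).map f = M := Subgroup.map_comap_eq_self_of_surjective hf M
    have h2 : M.comap f ≤ L := by
      rw [← Subgroup.comap_map_eq_self (hK.trans h.lt.le)]
      exact Subgroup.comap_mono hML
    rcases h.eq_or_eq (M.comap f) (hM.comap f) (Subgroup.map_le_iff_le_comap.1 hKM) h2 with h1 | h1
    · left; rw [← h1, hmc]
    · right; rw [← h1, hmc]

theorem Subgroup.relIndex_map_of_ker_le {H : Type*} [Group H] (f : G →* H)
    {K L : Subgroup G} (hK : f.ker ≤ K) : (K.map f).relIndex (L.map f) = K.relIndex L := by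
  rw [← Subgroup.relIndex_comap, Subgroup.comap_map_eq_self hK]

theorem isChiefFactor_bot_iff {L : Subgroup G} : IsChiefFactor ⊥ L ↔
    L.Normal ∧ L ≠ ⊥ ∧ ∀ M : Subgroup G, M.Normal → M ≤ L → M = ⊥ ∨ M = L :=
  ⟨fun h => ⟨h.normal_top, h.lt.ne', fun M hM hML => h.eq_or_eq M hM bot_le hML⟩,
    fun h => ⟨inferInstance, h.1, bot_lt_iff_ne_bot.2 h.2.1, fun M hM _ hML => h.2.2 M hM hML⟩⟩

/-- A nilpotent normal subgroup centralizes every minimal normal subgroup. -/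
theorem IsChiefFactor.commutator_eq_bot_of_isNilpotent {L M : Subgroup G} (h : IsChiefFactor ⊥ L)
    (hM : M.Normal) (hnil : Group.IsNilpotent M) : ⁅M, L⁆ = ⊥ := by
  have hL := h.normal_top
  rcases h.eq_or_eq ⁅L, M⁆ inferInstance bot_le (Subgroup.commutator_le_left _ _) with h1 | h1
  · rw [Subgroup.commutator_comm, h1]
  · exfalso
    obtain ⟨n, hn⟩ := (Subgroup.isNilpotent_iff_lowerCentralSeries M).1 hnil
    have key : ∀ n, L ≤ M.lowerCentralSeries n := by
      intro n
      induction n with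
      | zero => exact h1 ▸ Subgroup.commutator_le_right _ _
      | succ n ih =>
        rw [Subgroup.lowerCentralSeries_succ]
        exact h1.symm.le.trans (Subgroup.commutator_mono ih le_rfl)
    exact h.lt.not_ge (hn ▸ key n)

end ChiefFactors

/-! ### Centralizing all chief factors of order divisible by a prime of π. -/

section PiCentral

variable {G : Type u} [Group G]

/-- `D` centralizes every chief factor `L / K` of `G` between `M` and `N` whose order is divisible
by a prime in `π`. -/
def CentralizesPiFactors (π : Set Nat.Primes) (D M N : Subgroup G) : Prop :=
  ∀ K L : Subgroup G, IsChiefFactor K L → M ≤ K → L ≤ N →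
    (∃ p ∈ π, (p : ℕ) ∣ K.relIndex L) → ⁅D, L⁆ ≤ K

variable {π : Set Nat.Primes} {D M N : Subgroup G}

theorem CentralizesPiFactors.mono {M' N' : Subgroup G} (h : CentralizesPiFactors π D M N)
    (hM : M ≤ M') (hN : N' ≤ N) : CentralizesPiFactors π D M' N' :=
  fun K L hKL h1 h2 => h K L hKL (hM.trans h1) (h2.trans hN)

/-- Each chief factor is either covered or avoided by M, so it can be moved to an isomorphic one
below or above M. This replaces the Jordan–Hölder theorem: no chief series has to be chosen. -/
theorem CentralizesPiFactors.trans (hM : M.Normal)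
    (h1 : CentralizesPiFactors π D ⊥ M)
    (h2 : CentralizesPiFactors π D M N) (hMN : M ≤ N) : CentralizesPiFactors π D ⊥ N := by
  intro K L hKL _ hLN hp
  have hK := hKL.normal_bot
  have hL := hKL.normal_top
  rcases hKL.eq_or_eq ((L ⊓ M) ⊔ K) inferInstance le_sup_right (sup_le inf_le_left hKL.lt.le)
    with h | h
  · have hKM : L ⊓ (K ⊔ M) ≤ K := by
      rw [sup_comm, inf_sup_eq_of_le_of_normal hK hKL.lt.le, h]
    have := h2 _ _ (hKL.sup hM hKM) le_sup_right (sup_le hLN hMN)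
      (by rwa [hKL.relIndex_sup hM hKM])
    exact (le_inf (Subgroup.commutator_le_right _ _)
      ((Subgroup.commutator_mono le_rfl le_sup_left).trans this)).trans hKM
  · have := h1 _ _ (hKL.inf hM h.ge) bot_le inf_le_right (by rwa [hKL.relIndex_inf h.ge])
    rw [← h]
    exact commutator_sup_le hK (this.trans inf_le_left) (Subgroup.commutator_le_right D K)

/-- Every factor between M and NM is covered by N. -/
theorem CentralizesPiFactors.of_inf (hN : N.Normal)
    (h1 : CentralizesPiFactors π D ⊥ N) :
    CentralizesPiFactors π D M (N ⊔ M) := by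
  intro K L hKL hMK hLN hp
  have hK := hKL.normal_bot
  have hL := hKL.normal_top
  have hL' : L ≤ (L ⊓ N) ⊔ K := by
    rw [← inf_sup_eq_of_le_of_normal hK hKL.lt.le]
    exact le_inf le_rfl (hLN.trans (sup_le_sup_left hMK _))
  have := h1 _ _ (hKL.inf hN hL') bot_le inf_le_right (by rwa [hKL.relIndex_inf hL'])
  exact (Subgroup.commutator_mono le_rfl hL').trans
    (commutator_sup_le hK (this.trans inf_le_left) (Subgroup.commutator_le_right D K))

theorem CentralizesPiFactors.sup (hM : M.Normal) (hN : N.Normal)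
    (h1 : CentralizesPiFactors π D ⊥ M) (h2 : CentralizesPiFactors π D ⊥ N) :
    CentralizesPiFactors π D ⊥ (N ⊔ M) :=
  h1.trans hM (h2.of_inf hN) le_sup_right

theorem CentralizesPiFactors.comap {H : Type u} [Group H] {f : G →* H}
    (hf : Function.Surjective f) {N : Subgroup H}
    (h : CentralizesPiFactors π (D.map f) ⊥ N) :
    CentralizesPiFactors π D f.ker (N.comap f) := by
  intro K L hKL hK hL hp
  have := h _ _ (hKL.map_of_surjective hf hK) bot_le (Subgroup.map_le_iff_le_comap.2 hL)
    (by rwa [Subgroup.relIndex_map_of_ker_le f hK])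
  rwa [← Subgroup.map_commutator, Subgroup.map_le_iff_le_comap,
    Subgroup.comap_map_eq_self hK] at this

theorem CentralizesPiFactors.map {H : Type u} [Group H] {f : G →* H}
    (hf : Function.Surjective f)
    (h : CentralizesPiFactors π D f.ker N) (hN : f.ker ≤ N) :
    CentralizesPiFactors π (D.map f) ⊥ (N.map f) := by
  intro K L hKL _ hL hp
  have := h _ _ (hKL.comap_of_surjective hf) (Subgroup.comap_mono bot_le)
    ((Subgroup.comap_mono hL).trans (Subgroup.comap_map_eq_self hN).le)
    (by rwa [Subgroup.relIndex_comap, Subgroup.map_comap_eq_self_of_surjective hf])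
  rwa [← Subgroup.map_le_iff_le_comap, Subgroup.map_commutator,
    Subgroup.map_comap_eq_self_of_surjective hf] at this

end PiCentral

namespace GroupClass

/-! ### Residuals of groups and of subgroups. -/

section Residual

variable {F : GroupClass.{u}} {G : Type u} [Group G]

theorem IsFormation.mem_of_subsingleton (hF : F.IsFormation) [Subsingleton G] : F.Mem G := by
  obtain ⟨H, _, hH⟩ := hF.nonempty
  exact hF.image (1 : H →* G) (fun x => ⟨1, Subsingleton.elim _ _⟩) hH

theorem IsFormation.mem_quotient_inf (hF : F.IsFormation) {M N : Subgroup G} [M.Normal] [N.Normal]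
    (hM : F.Mem (G ⧸ M)) (hN : F.Mem (G ⧸ N)) : F.Mem (G ⧸ (M ⊓ N)) := by
  refine hF.subdirect
    (QuotientGroup.map (M ⊓ N) M (MonoidHom.id G) inf_le_left)
    (QuotientGroup.map (M ⊓ N) N (MonoidHom.id G) inf_le_right)
    (fun x => ?_) (fun x => ?_) ?_ hM hN
  · obtain ⟨g, rfl⟩ := QuotientGroup.mk_surjective x
    exact ⟨g, rfl⟩
  · obtain ⟨g, rfl⟩ := QuotientGroup.mk_surjective x
    exact ⟨g, rfl⟩
  · rw [injective_iff_map_eq_one]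
    intro x hx
    obtain ⟨g, rfl⟩ := QuotientGroup.mk_surjective x
    have h := Prod.ext_iff.1 hx
    exact (QuotientGroup.eq_one_iff _).2
      ⟨(QuotientGroup.eq_one_iff g).1 h.1, (QuotientGroup.eq_one_iff g).1 h.2⟩

theorem mem_quotient_congr {M N : Subgroup G} [M.Normal] [N.Normal] (h : M = N)
    (h' : F.Mem (G ⧸ M)) : F.Mem (G ⧸ N) := by
  subst h; exact h'

instance residual_normal : (F.residual G).Normal := by
  refine ⟨fun n hn g => ?_⟩
  rw [residual, Subgroup.mem_sInf] at hn ⊢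
  rintro N ⟨hN, hN'⟩
  exact hN.conj_mem n (hn N ⟨hN, hN'⟩) g

theorem IsFormation.mem_quotient_residual (hF : F.IsFormation) [Finite G] :
    F.Mem (G ⧸ F.residual G) := by
  obtain ⟨N, hN⟩ := (Set.toFinite {N : Subgroup G | ∃ _ : N.Normal, F.Mem (G ⧸ N)}).exists_minimal
    ⟨⊤, inferInstance, have := QuotientGroup.subsingleton_quotient_top (G := G)
      hF.mem_of_subsingleton⟩
  obtain ⟨hNn, hNF⟩ := hN.prop
  refine mem_quotient_congr (le_antisymm (le_sInf ?_) (sInf_le hN.prop)) hNF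
  rintro M ⟨hM, hMF⟩
  exact (hN.le_of_le ⟨inferInstance, hF.mem_quotient_inf hNF hMF⟩ inf_le_left).trans inf_le_right

theorem residual_le {N : Subgroup G} [hN : N.Normal] (h : F.Mem (G ⧸ N)) : F.residual G ≤ N :=
  sInf_le ⟨hN, h⟩

theorem residual_le_ker {H : Type u} [Group H] {f : G →* H}
    (hf : Function.Surjective f) (hH : F.Mem H) : F.residual G ≤ f.ker :=
  residual_le (F.iso (QuotientGroup.quotientKerEquivOfSurjective f hf).symm hH)

theorem IsFormation.mem_of_residual_le_ker (hF : F.IsFormation) [Finite G] {H : Type u} [Group H]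
    {f : G →* H} (hf : Function.Surjective f) (h : F.residual G ≤ f.ker) : F.Mem H :=
  hF.image (QuotientGroup.lift (F.residual G) f h)
    (fun y => (hf y).imp' (QuotientGroup.mk) fun _ h => h) hF.mem_quotient_residual

theorem IsFormation.residual_eq_bot_iff (hF : F.IsFormation) [Finite G] :
    F.residual G = ⊥ ↔ F.Mem G := by
  constructor
  · intro h
    exact hF.mem_of_residual_le_ker (f := MonoidHom.id G) Function.surjective_id (by rw [h]; simp)
  · intro h
    exact eq_bot_iff.2 <|
      (residual_le_ker (f := MonoidHom.id G) Function.surjective_id h).trans (by simp)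

theorem IsFormation.map_residual (hF : F.IsFormation) [Finite G] {H : Type u} [Group H]
    {f : G →* H} (hf : Function.Surjective f) : (F.residual G).map f = F.residual H := by
  have : Finite H := Finite.of_surjective f hf
  apply le_antisymm
  · rw [Subgroup.map_le_iff_le_comap]
    have h := residual_le_ker (f := (QuotientGroup.mk' (F.residual H)).comp f)
      ((QuotientGroup.mk'_surjective _).comp hf) hF.mem_quotient_residual
    rwa [← MonoidHom.comap_ker, QuotientGroup.ker_mk'] at h
  · have hn : ((F.residual G).map f).Normal := residual_normal.map f hf
    refine residual_le (hF.mem_of_residual_le_ker (G := G)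
      (f := (QuotientGroup.mk' ((F.residual G).map f)).comp f)
      ((QuotientGroup.mk'_surjective _).comp hf) ?_)
    rw [← MonoidHom.comap_ker, QuotientGroup.ker_mk']
    exact Subgroup.le_comap_map _ _

variable (F) in
/-- The `F`-residual of the subgroup `H`, as a subgroup of the ambient group. -/
def subgroupResidual (H : Subgroup G) : Subgroup G := (F.residual H).map H.subtype

theorem subgroupResidual_le (H : Subgroup G) : F.subgroupResidual H ≤ H :=
  Subgroup.map_subtype_le _

theorem IsFormation.map_subgroupResidual (hF : F.IsFormation) [Finite G] {G' : Type u} [Group G']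
    (f : G →* G') (H : Subgroup G) :
    (F.subgroupResidual H).map f = F.subgroupResidual (H.map f) := by
  rw [subgroupResidual, subgroupResidual, ← hF.map_residual (f.subgroupMap_surjective H),
    Subgroup.map_map, Subgroup.map_map]
  rfl

theorem IsFormation.subgroupResidual_top (hF : F.IsFormation) [Finite G] :
    F.subgroupResidual (⊤ : Subgroup G) = F.residual G :=
  hF.map_residual (f := (⊤ : Subgroup G).subtype) (fun x => ⟨⟨x, trivial⟩, rfl⟩)

theorem IsFormation.map_subtype_residual_le (hF : F.IsFormation) (hS : F.IsSubgroupClosed)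
    [Finite G] (H : Subgroup G) : F.subgroupResidual H ≤ F.residual G := by
  rw [subgroupResidual, Subgroup.map_le_iff_le_comap]
  let f := ((QuotientGroup.mk' (F.residual G)).comp H.subtype)
  have h := residual_le_ker f.rangeRestrict_surjective
    (hS f.range hF.mem_quotient_residual)
  rwa [MonoidHom.ker_rangeRestrict, ← MonoidHom.comap_ker, QuotientGroup.ker_mk'] at h

theorem IsFormation.subgroupResidual_mono (hF : F.IsFormation) (hS : F.IsSubgroupClosed)
    [Finite G] {H K : Subgroup G} (h : H ≤ K) : F.subgroupResidual H ≤ F.subgroupResidual K := by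
  have h1 := Subgroup.map_mono (f := K.subtype)
    (hF.map_subtype_residual_le hS (H.subgroupOf K))
  rwa [hF.map_subgroupResidual, Subgroup.map_subgroupOf_eq_of_le h] at h1

theorem IsFormation.normalizer_le_normalizer_subgroupResidual (hF : F.IsFormation) [Finite G]
    (H : Subgroup G) :
    Subgroup.normalizer (H : Set G) ≤ Subgroup.normalizer (F.subgroupResidual H : Set G) := by
  intro g hg
  rw [Subgroup.mem_normalizer_iff_map_conj_eq] at hg ⊢
  rw [hF.map_subgroupResidual, hg]

theorem IsFormation.subgroupResidual_eq_bot_iff (hF : F.IsFormation) [Finite G]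
    (H : Subgroup G) : F.subgroupResidual H = ⊥ ↔ F.Mem H := by
  rw [subgroupResidual, Subgroup.map_eq_bot_iff_of_injective _ H.subtype_injective,
    hF.residual_eq_bot_iff]

end Residual

/-! ### Radicals for sets of primes, and minimal normal subgroups. -/

section Radical

variable {σ : Set Nat.Primes} {G : Type u} [Group G]

theorem piGroups_mem_iff [Finite G] :
    (piGroups σ).Mem G ↔ ∀ p : Nat.Primes, (p : ℕ) ∣ Nat.card G → p ∈ σ :=
  ⟨fun h => h.2, fun h => ⟨‹_›, h⟩⟩

theorem piGroups_singleton_mem_iff [Finite G] {p : Nat.Primes} :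
    (piGroups {p}).Mem G ↔ IsPGroup p G := by
  have : Fact (p : ℕ).Prime := ⟨p.2⟩
  rw [piGroups_mem_iff, IsPGroup.iff_card]
  constructor
  · intro h
    refine ⟨_, Nat.eq_prime_pow_of_unique_prime_dvd Nat.card_pos.ne' fun {q} hq hd => ?_⟩
    exact congrArg Subtype.val (h ⟨q, hq⟩ hd)
  · rintro ⟨n, hn⟩ q hq
    rw [hn] at hq
    exact Subtype.ext ((Nat.prime_dvd_prime_iff_eq q.2 p.2).1 (q.2.dvd_of_dvd_pow hq))

theorem piGroups_mem_of_card_dvd {H : Type u} [Group H] [Finite H] [Finite G]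
    (h : Nat.card H ∣ Nat.card G) (hG : (piGroups σ).Mem G) : (piGroups σ).Mem H :=
  ⟨‹_›, fun p hp => hG.2 p (hp.trans h)⟩

theorem piGroups_mem_sup [Finite G] {M N : Subgroup G} [N.Normal] (hM : (piGroups σ).Mem M)
    (hN : (piGroups σ).Mem N) : (piGroups σ).Mem (M ⊔ N : Subgroup G) := by
  refine ⟨inferInstance, fun p hp => ?_⟩
  rw [← Subgroup.relIndex_bot_left, ← Subgroup.relIndex_mul_relIndex ⊥ N (M ⊔ N) bot_le le_sup_right,
    Subgroup.relIndex_bot_left, Subgroup.relIndex_sup_right] at hp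
  rcases p.2.dvd_mul.1 hp with h | h
  · exact hN.2 p h
  · exact hM.2 p (h.trans (Subgroup.relIndex_dvd_card _ _))

instance radical_normal (X : GroupClass.{u}) : (X.radical G).Normal :=
  ⟨fun n hn g => X.radical_map_le (MulAut.conj g) ⟨n, hn, rfl⟩⟩

theorem piGroups_mem_radical [Finite G] : (piGroups σ).Mem ((piGroups σ).radical G) := by
  obtain ⟨N, hN⟩ := (Set.toFinite {N : Subgroup G | N.Normal ∧ (piGroups σ).Mem N}).exists_maximal
    ⟨⊥, inferInstance, inferInstance, fun p hp => absurd hp (by simpa using p.2.one_lt.ne')⟩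
  have h : (piGroups σ).radical G = N := by
    refine le_antisymm (sSup_le ?_) (le_sSup hN.prop)
    rintro M ⟨hM, hM'⟩
    have := hN.prop.1
    exact le_sup_left.trans
      (hN.le_of_ge ⟨inferInstance, piGroups_mem_sup hM' hN.prop.2⟩ le_sup_right)
  rw [h]
  exact hN.prop.2

theorem le_radical {X : GroupClass.{u}} {N : Subgroup G} (hN : N.Normal) (h : X.Mem N) :
    N ≤ X.radical G := le_sSup ⟨hN, h⟩

/-- A `σ`-subgroup that is normal in a normal subgroup `D` of `G` is contained in a normal
`σ`-subgroup of `G` below `D`. -/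
theorem exists_normal_piGroup_ge [Finite G] {D X : Subgroup G} (hD : D.Normal) (hXD : X ≤ D)
    (hX : (X.subgroupOf D).Normal) (h : (piGroups σ).Mem X) :
    ∃ R : Subgroup G, R.Normal ∧ X ≤ R ∧ R ≤ D ∧ (piGroups σ).Mem R := by
  -- The σ-radical of D is characteristic in D, hence normal in G.
  refine ⟨((piGroups σ).radical D).map D.subtype, ?_, ?_, Subgroup.map_subtype_le _, ?_⟩
  · refine ⟨?_⟩
    rintro _ ⟨x, hx, rfl⟩ g
    exact ⟨MulAut.conjNormal g x,
      (piGroups σ).radical_map_le (MulAut.conjNormal g) ⟨x, hx, rfl⟩, rfl⟩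
  · rw [← Subgroup.map_subgroupOf_eq_of_le hXD]
    exact Subgroup.map_mono
      (le_radical hX ((piGroups σ).iso (Subgroup.subgroupOfEquivOfLe hXD).symm h))
  · exact (piGroups σ).iso (((piGroups σ).radical D).equivMapOfInjective D.subtype
      D.subtype_injective) piGroups_mem_radical

/-- A minimal normal subgroup with a nontrivial normal `σ`-subgroup is a `σ`-group. -/
theorem _root_.IsChiefFactor.piGroups_mem_of_normal [Finite G] {L X : Subgroup G}
    (hL : IsChiefFactor ⊥ L) (hXL : X ≤ L) (hX0 : X ≠ ⊥) (hX : (X.subgroupOf L).Normal)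
    (h : (piGroups σ).Mem X) : (piGroups σ).Mem L := by
  obtain ⟨R, hR, hXR, hRL, hRσ⟩ := exists_normal_piGroup_ge hL.normal_top hXL hX h
  rcases hL.eq_or_eq R hR bot_le hRL with h1 | h1
  · exact absurd (eq_bot_iff.2 (h1 ▸ hXR)) hX0
  · rwa [← h1]

theorem _root_.IsChiefFactor.commutator_self_of_isPGroup [Finite G] {L : Subgroup G}
    (hL : IsChiefFactor ⊥ L) {p : ℕ} [Fact p.Prime] (h : IsPGroup p L) : ⁅L, L⁆ = ⊥ :=
  hL.commutator_eq_bot_of_isNilpotent hL.normal_top h.isNilpotent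

/-- An abelian minimal normal subgroup whose order is divisible by the prime `p` is a `p`-group. -/
theorem _root_.IsChiefFactor.isPGroup_of_commutator_self [Finite G] {L : Subgroup G}
    (hL : IsChiefFactor ⊥ L) {p : Nat.Primes} (hp : (p : ℕ) ∣ Nat.card L) (h : ⁅L, L⁆ = ⊥) :
    IsPGroup p L := by
  have : Fact (p : ℕ).Prime := ⟨p.2⟩
  obtain ⟨x, hx⟩ := exists_prime_orderOf_dvd_card' (p : ℕ) hp
  have hxp : orderOf (x : G) = p := by rw [Subgroup.orderOf_coe, hx]
  have hxL : Subgroup.zpowers (x : G) ≤ L := by simp [Subgroup.zpowers_le]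
  rw [← piGroups_singleton_mem_iff]
  -- The subgroup generated by an element of order p is a p-group, and it is normal in the abelian
  -- group L.
  refine IsChiefFactor.piGroups_mem_of_normal hL hxL ?_ ?_ ?_
  · rw [Ne, Subgroup.zpowers_eq_bot, ← orderOf_eq_one_iff, hxp]
    exact p.2.one_lt.ne'
  · refine ⟨fun n hn g => ?_⟩
    have hc : g * n * g⁻¹ = n := by
      have := Subgroup.commutator_mem_commutator g.2 n.2
      rw [h, Subgroup.mem_bot, commutatorElement_eq_one_iff_mul_comm] at this
      rw [mul_inv_eq_iff_eq_mul]
      exact Subtype.ext this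
    rwa [hc]
  · rw [piGroups_singleton_mem_iff, IsPGroup.iff_card]
    exact ⟨1, by rw [Nat.card_zpowers, hxp, pow_one]⟩

end Radical

end GroupClass

namespace GroupClass

/-! ### Centrality for N ∘ F as centralization by the residual. -/

section CentralFactor

open scoped commutatorElement

variable {F : GroupClass.{u}} {G : Type u} [Group G]

/-- The action on `V` of the semidirect product `V ⋊[φ] A`. -/
def semidirectAction {V A : Type u} [Group V] [Group A] (φ : A →* MulAut V) :
    V ⋊[φ] A →* MulAut V :=
  SemidirectProduct.lift MulAut.conj φ fun a => by ext v w; simp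

theorem semidirectAction_range {V A : Type u} [Group V] [Group A] {φ : A →* MulAut V}
    (hφ : (MulAut.conj : V →* MulAut V).range ≤ φ.range) :
    (semidirectAction φ).range = φ.range := by
  apply le_antisymm
  · rintro _ ⟨x, rfl⟩
    exact φ.range.mul_mem (hφ ⟨x.left, rfl⟩) ⟨x.right, rfl⟩
  · rintro _ ⟨a, rfl⟩
    exact ⟨SemidirectProduct.inr a, by simp [semidirectAction]⟩

/-- The intersection of the kernels of `V ⋊ A → A` and of the action of `V ⋊ A` on `V` is the centre
of `V`, so every subgroup of it is nilpotent. -/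
theorem isNilpotent_of_le_ker {V A : Type u} [Group V] [Group A] {φ : A →* MulAut V}
    {R : Subgroup (V ⋊[φ] A)} (h1 : R ≤ SemidirectProduct.rightHom.ker)
    (h2 : R ≤ (semidirectAction φ).ker) : Group.IsNilpotent R := by
  refine Subgroup.isNilpotent_of_ker_le_center (1 : R →* Unit) (fun x _ => ?_)
  rw [Subgroup.mem_center_iff]
  intro y
  apply Subtype.ext
  have hx1 : (x : V ⋊[φ] A).right = 1 := h1 x.2
  have hy1 : (y : V ⋊[φ] A).right = 1 := h1 y.2
  have hx2 : semidirectAction φ x = 1 := h2 x.2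
  have hx3 := DFunLike.congr_fun hx2 (y : V ⋊[φ] A).left
  simp only [semidirectAction, SemidirectProduct.lift, MonoidHom.coe_mk, OneHom.coe_mk, hx1,
    map_one, mul_one, MulAut.conj_apply, MulAut.one_apply] at hx3
  rw [mul_inv_eq_iff_eq_mul] at hx3
  ext
  · simp [hx1, hy1, hx3]
  · simp [hx1, hy1]

/-- By `hirr`, V is minimal normal in E = V ⋊ A. If the residual of E is nilpotent it centralizes V,
so it dies in the image of the action on V, which is isomorphic to A by `hinj` and `hφ`. Conversely,
if A ∈ F, the residual lies in the kernels of both maps from E onto copies of A, and these meet in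
the centre of V. -/
theorem nilpotent_prod_mem_semidirect_iff (hF : F.IsFormation) {V A : Type u} [Group V] [Group A]
    [Finite V] [Finite A] [Nontrivial V] {φ : A →* MulAut V} (hinj : Function.Injective φ)
    (hφ : (MulAut.conj : V →* MulAut V).range ≤ φ.range)
    (hirr : ∀ S : Subgroup V, (∀ a, ∀ v ∈ S, φ a v ∈ S) → S = ⊥ ∨ S = ⊤) :
    (nilpotentGroups.prod F).Mem (V ⋊[φ] A) ↔ F.Mem A := by
  have hfin : Finite (V ⋊[φ] A) := Finite.of_equiv _ SemidirectProduct.equivProd.symm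
  let e : A ≃* φ.range := MonoidHom.ofInjective hinj
  let g : V ⋊[φ] A →* φ.range :=
    (semidirectAction φ).codRestrict φ.range fun x => by
      rw [← semidirectAction_range hφ]; exact ⟨x, rfl⟩
  have hg : Function.Surjective g := by
    rintro ⟨y, hy⟩
    have hy' := hy
    rw [← semidirectAction_range hφ] at hy'
    obtain ⟨x, hx⟩ := hy'
    exact ⟨x, Subtype.ext hx⟩
  have hgker : g.ker = (semidirectAction φ).ker := MonoidHom.ker_codRestrict _ _ _
  constructor
  · rintro ⟨-, -, hnil⟩
    refine F.iso e.symm (hF.mem_of_residual_le_ker hg ?_)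
    rw [hgker]
    let W : Subgroup (V ⋊[φ] A) := (SemidirectProduct.inl : V →* V ⋊[φ] A).range
    have hWn : W.Normal := by
      simp only [W, SemidirectProduct.range_inl_eq_ker_rightHom]
      infer_instance
    have hW : IsChiefFactor ⊥ W := by
      rw [isChiefFactor_bot_iff]
      refine ⟨hWn, ?_, ?_⟩
      · intro h0
        obtain ⟨v, hv⟩ := exists_ne (1 : V)
        have hv' : (SemidirectProduct.inl v : V ⋊[φ] A) ∈ W := ⟨v, rfl⟩
        rw [h0, Subgroup.mem_bot] at hv'
        exact hv (SemidirectProduct.inl_injective (hv'.trans (map_one _).symm))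
      · intro M hM hMW
        have hMe : (M.comap SemidirectProduct.inl).map SemidirectProduct.inl = M :=
          Subgroup.map_comap_eq_self hMW
        rcases hirr (M.comap SemidirectProduct.inl) (fun a v hv => by
          rw [Subgroup.mem_comap, SemidirectProduct.inl_aut]
          rw [map_inv]
          exact hM.conj_mem _ hv _) with h | h
        · left; rw [← hMe, h, Subgroup.map_bot]
        · right; rw [← hMe, h, ← MonoidHom.range_eq_map]
    have hc := hW.commutator_eq_bot_of_isNilpotent residual_normal hnil
    intro x hx
    rw [MonoidHom.mem_ker]
    ext v
    have hv := Subgroup.commutator_mem_commutator hx (show SemidirectProduct.inl v ∈ W from ⟨v, rfl⟩)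
    rw [hc, Subgroup.mem_bot, commutatorElement_eq_one_iff_mul_comm] at hv
    have hl := congrArg SemidirectProduct.left hv
    simp only [SemidirectProduct.mul_left, SemidirectProduct.left_inl,
      SemidirectProduct.right_inl, map_one, MulAut.one_apply] at hl
    simp [semidirectAction, SemidirectProduct.lift, hl]
  · intro hA
    refine ⟨hfin, inferInstance, isNilpotent_of_le_ker ?_ ?_⟩
    · exact residual_le_ker SemidirectProduct.rightHom_surjective hA
    · rw [← hgker]
      exact residual_le_ker hg (F.iso e hA)

theorem mem_ker_factorAction {K L : Subgroup G} [K.Normal] [L.Normal] {g : G} :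
    g ∈ (factorAction K L).ker ↔ ∀ l ∈ L, ⁅g, l⁆ ∈ K := by
  rw [MonoidHom.mem_ker]
  constructor
  · intro h l hl
    have h1 := congrArg Subtype.val (DFunLike.congr_fun h
      (⟨QuotientGroup.mk' K l, l, hl, rfl⟩ : L.map (QuotientGroup.mk' K)))
    rw [← QuotientGroup.eq_one_iff]
    have h2 : (QuotientGroup.mk' K g) * (QuotientGroup.mk' K l) * (QuotientGroup.mk' K g)⁻¹ =
      QuotientGroup.mk' K l := h1
    rw [commutatorElement_def, ← QuotientGroup.mk'_apply, map_mul, map_mul, map_mul, map_inv, h2,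
      map_inv, mul_inv_cancel]
  · intro h
    ext ⟨_, l, hl, rfl⟩
    have h1 := (QuotientGroup.eq_one_iff _).2 (h l hl)
    rw [commutatorElement_def, ← QuotientGroup.mk'_apply, map_mul, map_mul, map_mul, map_inv,
      map_inv, mul_inv_eq_one] at h1
    exact h1

theorem le_ker_factorAction {D K L : Subgroup G} [K.Normal] [L.Normal] :
    D ≤ (factorAction K L).ker ↔ ⁅D, L⁆ ≤ K := by
  rw [Subgroup.commutator_le]
  exact forall₂_congr fun g _ => mem_ker_factorAction

/-- A chief factor of `G` is central with respect to `N ∘ F` if and only if it is centralized by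
the `F`-residual of `G`. -/
theorem isCentralFactor_iff (hF : F.IsFormation) [Finite G] {K L : Subgroup G} [K.Normal]
    [L.Normal] (h : IsChiefFactor K L) :
    (nilpotentGroups.prod F).IsCentralFactor K L ↔ ⁅F.residual G, L⁆ ≤ K := by
  have hLn : (L.map (QuotientGroup.mk' K)).Normal :=
    Subgroup.Normal.map ‹_› _ (QuotientGroup.mk'_surjective K)
  have hnt : Nontrivial (L.map (QuotientGroup.mk' K)) := by
    rw [Subgroup.nontrivial_iff_ne_bot, Ne, Subgroup.map_eq_bot_iff, QuotientGroup.ker_mk']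
    exact h.lt.not_ge
  rw [IsCentralFactor, nilpotent_prod_mem_semidirect_iff hF
    (QuotientGroup.kerLift_injective _), ← le_ker_factorAction]
  · constructor
    · exact fun h => residual_le h
    · intro h
      exact hF.mem_of_residual_le_ker (QuotientGroup.mk'_surjective _)
        (by rwa [QuotientGroup.ker_mk'])
  · rintro _ ⟨⟨_, l, hl, rfl⟩, rfl⟩
    -- The inner automorphism of L / K given by l is the action of l as an element of G.
    refine ⟨(l : G ⧸ (factorAction K L).ker), ?_⟩
    ext x
    rfl
  · intro S hS
    have hSn : (S.map (L.map (QuotientGroup.mk' K)).subtype).Normal := by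
      refine ⟨?_⟩
      rintro _ ⟨x, hx, rfl⟩ g
      obtain ⟨g, rfl⟩ := QuotientGroup.mk'_surjective K g
      exact ⟨_, hS (g : G ⧸ (factorAction K L).ker) x hx, rfl⟩
    have hc := h.map_of_surjective (QuotientGroup.mk'_surjective K)
      (by rw [QuotientGroup.ker_mk'])
    rcases hc.eq_or_eq _ hSn (by rw [QuotientGroup.map_mk'_self]; exact bot_le)
      (Subgroup.map_subtype_le _) with h1 | h1
    · left
      rwa [QuotientGroup.map_mk'_self, Subgroup.map_eq_bot_iff_of_injective _
        (Subgroup.subtype_injective _)] at h1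
    · right
      apply Subgroup.map_injective (Subgroup.subtype_injective _)
      rw [h1, ← MonoidHom.range_eq_map, Subgroup.range_subtype]

end CentralFactor

/-! ### The hypercentre as the largest hypercentral normal subgroup. -/

section Hypercentre

variable {π : Set Nat.Primes} {F : GroupClass.{u}} {G : Type u} [Group G]

theorem isHypercentral_iff (hF : F.IsFormation) [Finite G] {N : Subgroup G} :
    IsHypercentral π (nilpotentGroups.prod F) N ↔
      N.Normal ∧ CentralizesPiFactors π (F.residual G) ⊥ N := by
  refine and_congr_right fun _ => ⟨?_, ?_⟩
  · intro h K L hKL _ hL hp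
    have := hKL.normal_bot
    have := hKL.normal_top
    exact (isCentralFactor_iff hF hKL).1 (h K L hKL hL hp)
  · intro h K L _ _ hKL hL hp
    exact (isCentralFactor_iff hF hKL).2 (h K L hKL bot_le hL hp)

theorem isHypercentral_hypercentre (hF : F.IsFormation) [Finite G] :
    (hypercentre π (nilpotentGroups.prod F) G).Normal ∧
    CentralizesPiFactors π (F.residual G) ⊥ (hypercentre π (nilpotentGroups.prod F) G) := by
  obtain ⟨N, hN⟩ := (Set.toFinite {N : Subgroup G | N.Normal ∧
    CentralizesPiFactors π (F.residual G) ⊥ N}).exists_maximal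
    ⟨⊥, inferInstance, fun K L hKL _ hL _ => absurd (hL.trans bot_le) hKL.lt.not_ge⟩
  have h : hypercentre π (nilpotentGroups.prod F) G = N := by
    refine le_antisymm (sSup_le fun M hM => ?_) (le_sSup ((isHypercentral_iff hF).2 hN.prop))
    obtain ⟨hM1, hM2⟩ := (isHypercentral_iff hF).1 hM
    have := hN.prop.1
    exact le_sup_left.trans (hN.le_of_ge ⟨inferInstance, hN.prop.2.sup hN.prop.1 hM1 hM2⟩
      le_sup_right)
  rw [h]
  exact hN.prop

theorem le_hypercentre (hF : F.IsFormation) [Finite G] {N : Subgroup G} (hN : N.Normal)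
    (h : CentralizesPiFactors π (F.residual G) ⊥ N) :
    N ≤ hypercentre π (nilpotentGroups.prod F) G :=
  le_sSup ((isHypercentral_iff hF).2 ⟨hN, h⟩)

end Hypercentre

end GroupClass

namespace GroupClass

/-! ### The norm, its series, and comparison with the hypercentre. -/

section Norm

variable {π σ : Set Nat.Primes} {F : GroupClass.{u}} {G : Type u} [Group G]

theorem mem_norm_iff {X : GroupClass.{u}} {x : G} : x ∈ X.norm F G ↔ ∀ H : Subgroup G,
    x ∈ Subgroup.normalizer ((F.subgroupResidual H ⊔ X.radical G : Subgroup G) : Set G) := by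
  rw [norm, Subgroup.mem_iInf]; rfl

theorem radical_le_norm (X : GroupClass.{u}) : X.radical G ≤ X.norm F G :=
  fun _ hx => mem_norm_iff.2 fun _ => Subgroup.le_normalizer (le_sup_right (b := X.radical G) hx)

theorem map_radical_piGroups_le [Finite G] {H : Type u} [Group H] {f : G →* H}
    (hf : Function.Surjective f) :
    ((piGroups σ).radical G).map f ≤ (piGroups σ).radical H := by
  have : Finite H := Finite.of_surjective f hf
  exact le_radical ((radical_normal _).map f hf)
    (piGroups_mem_of_card_dvd (Subgroup.card_map_dvd _ _) piGroups_mem_radical)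

/-- The residual of the preimage of Y maps onto the residual of Y. The radical of G may map to a
proper subgroup of the radical of H, but joining with the latter, which is normal, preserves
normalization. -/
theorem map_norm_le (hF : F.IsFormation) [Finite G] {H : Type u} [Group H] {f : G →* H}
    (hf : Function.Surjective f) :
    ((piGroups σ).norm F G).map f ≤ (piGroups σ).norm F H := by
  rintro _ ⟨x, hx, rfl⟩
  rw [mem_norm_iff]
  intro Y
  have h1 := Subgroup.le_normalizer_map f ⟨x, mem_norm_iff.1 hx (Y.comap f), rfl⟩
  rw [Subgroup.map_sup, hF.map_subgroupResidual,
    Subgroup.map_comap_eq_self_of_surjective hf] at h1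
  have h2 : f x ∈ Subgroup.normalizer ((piGroups σ).radical H : Set H) := by
    rw [Subgroup.normalizer_eq_top]; trivial
  have h3 := Subgroup.normalizer_inf_normalizer_le_normalizer_sup _ _
    (Subgroup.mem_inf.2 ⟨h1, h2⟩)
  rwa [sup_assoc, sup_eq_right.2 (map_radical_piGroups_le hf)] at h3

/-- As F is subgroup-closed, residuals of subgroups lie in the residual of G, so L centralizes all
of them. -/
theorem le_norm_of_commutator_eq_bot (hF : F.IsFormation) (hS : F.IsSubgroupClosed) [Finite G]
    {X : GroupClass.{u}} {L : Subgroup G} (h : ⁅F.residual G, L⁆ = ⊥) : L ≤ X.norm F G := by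
  intro x hx
  rw [mem_norm_iff]
  intro Y
  refine Subgroup.normalizer_inf_normalizer_le_normalizer_sup _ _
    (Subgroup.mem_inf.2 ⟨?_, by rw [Subgroup.normalizer_eq_top]; trivial⟩)
  rw [Subgroup.commutator_comm, Subgroup.commutator_eq_bot_iff_le_centralizer] at h
  exact Subgroup.centralizer_le_normalizer _
    (Subgroup.centralizer_le (hF.map_subtype_residual_le hS Y) (h hx))

theorem mem_normalizer_subgroupResidual {X : GroupClass.{u}} (h0 : X.radical G = ⊥) {x : G}
    (hx : x ∈ X.norm F G) (H : Subgroup G) :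
    x ∈ Subgroup.normalizer (F.subgroupResidual H : Set G) := by
  have := mem_norm_iff.1 hx H
  rwa [h0, sup_bot_eq] at this

/-- With trivial radical the norm normalizes the residuals themselves, a condition inherited by M;
joining with any normal subgroup of M preserves it, so Y is arbitrary. -/
theorem subgroupOf_norm_le (hF : F.IsFormation) [Finite G] {X Y : GroupClass.{u}}
    (h0 : X.radical G = ⊥) (M : Subgroup G) :
    (X.norm F G).subgroupOf M ≤ Y.norm F M := by
  intro x hx
  rw [mem_norm_iff]
  intro H
  refine Subgroup.normalizer_inf_normalizer_le_normalizer_sup _ _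
    (Subgroup.mem_inf.2 ⟨?_, by rw [Subgroup.normalizer_eq_top]; trivial⟩)
  have h1 := mem_normalizer_subgroupResidual h0 (Subgroup.mem_subgroupOf.1 hx) (H.map M.subtype)
  rw [← hF.map_subgroupResidual, Subgroup.mem_normalizer_iff] at h1
  rw [Subgroup.mem_normalizer_iff]
  intro y
  have h2 := h1 y
  rw [← Subgroup.coe_subtype, Subgroup.mem_map_iff_mem M.subtype_injective] at h2
  rw [h2, ← Subgroup.mem_map_iff_mem M.subtype_injective]
  simp

instance normSeries_normal (X : GroupClass.{u}) (i : ℕ) : (X.normSeries F G i).Normal :=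
  (normSeriesAux X F G i).2

theorem normSeries_succ (X : GroupClass.{u}) (i : ℕ) : X.normSeries F G (i + 1) =
    (X.norm F (G ⧸ X.normSeries F G i)).comap (QuotientGroup.mk' (X.normSeries F G i)) := rfl

theorem normSeries_mono (X : GroupClass.{u}) : Monotone (X.normSeries F G) := by
  refine monotone_nat_of_le_succ fun i => ?_
  rw [normSeries_succ]
  exact (QuotientGroup.ker_mk' _).symm.le.trans (Subgroup.comap_mono bot_le)

theorem exists_normInfty_eq [Finite G] (X : GroupClass.{u}) : ∃ i,
    X.normInfty F G = X.normSeries F G i ∧ X.norm F (G ⧸ X.normSeries F G i) = ⊥ := by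
  obtain ⟨i, hi⟩ := WellFoundedGT.monotone_chain_condition ⟨_, X.normSeries_mono (F := F) (G := G)⟩
  refine ⟨i, le_antisymm (iSup_le fun j => ?_) (le_iSup _ i), ?_⟩
  · rcases le_total i j with h | h
    · exact (hi j h).ge
    · exact normSeries_mono X h
  · have h1 : X.normSeries F G i = X.normSeries F G (i + 1) := hi (i + 1) i.le_succ
    rw [normSeries_succ] at h1
    rw [← Subgroup.map_comap_eq_self_of_surjective (QuotientGroup.mk'_surjective _)
      (X.norm F (G ⧸ X.normSeries F G i)), ← h1, QuotientGroup.map_mk'_self]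

theorem norm_le_normInfty (hF : F.IsFormation) [Finite G] :
    (piGroups σ).norm F G ≤ (piGroups σ).normInfty F G := by
  -- The first term of the series is defined through G ⧸ ⊥, so the norm is carried along the
  -- projection.
  refine le_trans ?_ (le_iSup _ 1)
  rw [normSeries_succ, ← Subgroup.map_le_iff_le_comap]
  exact map_norm_le hF (QuotientGroup.mk'_surjective _)

theorem hypercentre_le_normInfty (hF : F.IsFormation) (hS : F.IsSubgroupClosed) [Finite G] :
    hypercentre π (nilpotentGroups.prod F) G ≤ (piGroups πᶜ).normInfty F G := by
  obtain ⟨hZn, hZ⟩ := isHypercentral_hypercentre (π := π) (G := G) hF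
  obtain ⟨i, hi, hi0⟩ := (piGroups πᶜ).exists_normInfty_eq (F := F) (G := G)
  rw [hi]
  by_contra hcon
  set Z := hypercentre π (nilpotentGroups.prod F) G
  set K := (piGroups πᶜ).normSeries F G i
  obtain ⟨L, hKL, hL⟩ := exists_isChiefFactor (N := Z ⊔ K) (inferInstance : K.Normal)
    inferInstance (lt_of_le_of_ne le_sup_right fun h => hcon (h ▸ le_sup_left))
  have hLn := hKL.normal_top
  have hs := QuotientGroup.mk'_surjective K
  have hLn' := hLn.map _ hs
  -- This contradicts the triviality of the norm of G ⧸ K. If a prime of π divides |L / K|, the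
  -- factor is covered by Z and so centralized by the residual; otherwise it lies in the π'-radical.
  have : L.map (QuotientGroup.mk' K) ≤ (piGroups πᶜ).norm F (G ⧸ K) := by
    by_cases hp : ∃ p ∈ π, (p : ℕ) ∣ K.relIndex L
    · have h1 := hZ.of_inf hZn K L hKL le_rfl hL hp
      apply le_norm_of_commutator_eq_bot hF hS
      rwa [← hF.map_residual hs, ← Subgroup.map_commutator, Subgroup.map_eq_bot_iff,
        QuotientGroup.ker_mk']
    · refine (le_radical (X := piGroups πᶜ) hLn' ⟨inferInstance, fun p hp' hpπ => hp ⟨p, hpπ, ?_⟩⟩).trans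
        (radical_le_norm _)
      rwa [← Subgroup.relIndex_ker, QuotientGroup.ker_mk'] at hp'
  rw [hi0, Subgroup.map_le_iff_le_comap] at this
  exact hKL.lt.not_ge (this.trans (QuotientGroup.ker_mk' K).le)

/-- If the norm of every quotient of `G` is hypercentral, then so is every term of the norm
series. -/
theorem normEqHypercentre_of_quotients (hF : F.IsFormation) (hS : F.IsSubgroupClosed) [Finite G]
    (h : ∀ (N : Subgroup G) [N.Normal], CentralizesPiFactors π (F.residual (G ⧸ N)) ⊥
      ((piGroups πᶜ).norm F (G ⧸ N))) : F.NormEqHypercentre π G := by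
  refine le_antisymm ?_ (hypercentre_le_normInfty hF hS)
  refine iSup_le fun i => le_hypercentre hF inferInstance ?_
  induction i with
  | zero => exact fun K L hKL _ hL _ => absurd (hL.trans bot_le) hKL.lt.not_ge
  | succ i ih =>
    have h1 := h ((piGroups πᶜ).normSeries F G i)
    rw [← hF.map_residual (QuotientGroup.mk'_surjective _)] at h1
    have h2 := h1.comap (QuotientGroup.mk'_surjective _)
    rw [QuotientGroup.ker_mk'] at h2
    exact ih.trans inferInstance h2 (normSeries_mono _ i.le_succ)

theorem NormEqHypercentre.centralizesPiFactors_norm (hF : F.IsFormation) [Finite G]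
    (h : F.NormEqHypercentre π G) :
    CentralizesPiFactors π (F.residual G) ⊥ ((piGroups πᶜ).norm F G) :=
  (isHypercentral_hypercentre hF).2.mono le_rfl ((norm_le_normInfty hF).trans h.le)

end Norm

end GroupClass

/-! ### Schur–Zassenhaus and Frattini arguments for complements. -/

section Complements

open scoped commutatorElement

open MulAction Pointwise in
/-- Complements of an abelian normal Hall subgroup are stabilizers. -/
theorem Subgroup.IsComplement'.exists_eq_stabilizer {G : Type*} [Group G] [Finite G]
    {H K : Subgroup G} [IsMulCommutative H] [H.Normal] (hH : Nat.Coprime (Nat.card H) H.index)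
    (h : H.IsComplement' K) : ∃ α : H.QuotientDiff, K = stabilizer G α := by
  -- K is itself a transversal of H. Its class is fixed by K, and comparing orders shows that K is
  -- the whole stabilizer.
  let T : H.LeftTransversal := ⟨(K : Set G), h.symm⟩
  let α : H.QuotientDiff := Quotient.mk'' T
  refine ⟨α, ?_⟩
  have hle : K ≤ stabilizer G α := by
    intro k hk
    rw [mem_stabilizer_iff]
    refine congrArg Quotient.mk'' (Subtype.ext ?_)
    change MulOpposite.op k⁻¹ • (K : Set G) = K
    exact op_smul_coe_set (K.inv_mem hk)
  have hc := Subgroup.isComplement'_stabilizer_of_coprime hH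
    (α := α)
  refine Subgroup.eq_of_le_of_card_ge hle (le_of_eq ?_)
  have h1 := h.card_mul_card
  rw [← hc.card_mul_card] at h1
  exact (Nat.eq_of_mul_eq_mul_left Nat.card_pos h1).symm

open MulAction Pointwise in
-- Both complements are stabilizers of points of `H.QuotientDiff`, on which H acts transitively.
theorem Subgroup.IsComplement'.exists_conj_eq {G : Type*} [Group G] [Finite G]
    {H K₁ K₂ : Subgroup G} (hcomm : IsMulCommutative H) (hn : H.Normal)
    (hH : Nat.Coprime (Nat.card H) H.index)
    (h₁ : H.IsComplement' K₁) (h₂ : H.IsComplement' K₂) :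
    ∃ h ∈ H, K₁.map (MulAut.conj h : G →* G) = K₂ := by
  obtain ⟨α, rfl⟩ := h₁.exists_eq_stabilizer hH
  obtain ⟨β, rfl⟩ := h₂.exists_eq_stabilizer hH
  obtain ⟨h, rfl⟩ := Subgroup.exists_smul_eq hH α β
  refine ⟨h, h.2, ?_⟩
  exact (stabilizer_smul_eq_stabilizer_map_conj (h : G) α).symm

variable {G : Type u} [Group G]

/-- The Frattini argument for complements of an abelian normal subgroup `L` of coprime index in a
normal subgroup `R`. -/
theorem exists_complement_normalizer_sup_eq_top [Finite G] {L R : Subgroup G} (hL : L.Normal)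
    (hLab : ⁅L, L⁆ = ⊥) (hR : R.Normal) (hLR : L ≤ R)
    (hco : Nat.Coprime (Nat.card L) (L.relIndex R)) :
    ∃ K : Subgroup G, K ⊓ L = ⊥ ∧ K ⊔ L = R ∧ Subgroup.normalizer (K : Set G) ⊔ L = ⊤ := by
  have hcard : Nat.card (L.subgroupOf R) = Nat.card L :=
    Nat.card_congr (Subgroup.subgroupOfEquivOfLe hLR).toEquiv
  have hco' : Nat.Coprime (Nat.card (L.subgroupOf R)) (L.subgroupOf R).index := by
    rw [hcard]; exact hco
  have hcomm : IsMulCommutative (L.subgroupOf R) := by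
    refine ⟨⟨fun a b => ?_⟩⟩
    have := Subgroup.commutator_mem_commutator (Subgroup.mem_subgroupOf.1 a.2)
      (Subgroup.mem_subgroupOf.1 b.2)
    rw [hLab, Subgroup.mem_bot, commutatorElement_eq_one_iff_mul_comm] at this
    exact Subtype.ext (Subtype.ext this)
  obtain ⟨K, hK⟩ := Subgroup.exists_right_complement'_of_coprime hco'
  refine ⟨K.map R.subtype, ?_, ?_, ?_⟩
  · conv_lhs => rw [← Subgroup.map_subgroupOf_eq_of_le hLR]
    rw [← Subgroup.map_inf_eq _ _ _ R.subtype_injective, hK.symm.disjoint.eq_bot,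
      Subgroup.map_bot]
  · conv_lhs => rw [← Subgroup.map_subgroupOf_eq_of_le hLR]
    rw [← Subgroup.map_sup, hK.symm.sup_eq_top, ← MonoidHom.range_eq_map, Subgroup.range_subtype]
  · rw [eq_top_iff]
    intro g _
    let a : R ≃* R := MulAut.conjNormal g
    have hLa : (L.subgroupOf R).map (a : R →* R) = L.subgroupOf R := by
      ext x
      constructor
      · rintro ⟨y, hy, rfl⟩
        exact hL.conj_mem _ hy g
      · intro hx
        refine ⟨a.symm x, ?_, a.apply_symm_apply x⟩
        have : g⁻¹ * x * g ∈ L := by simpa using hL.conj_mem _ hx g⁻¹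
        rwa [← MulAut.conjNormal_symm_apply] at this
    have hKa : (L.subgroupOf R).IsComplement' (K.map (a : R →* R)) := by
      refine Subgroup.isComplement'_of_disjoint_and_mul_eq_univ ?_ ?_
      · rw [← hLa, disjoint_iff,
          ← Subgroup.map_inf_eq _ _ (a : R →* R) a.injective, hK.disjoint.eq_bot,
          Subgroup.map_bot]
      · rw [← Subgroup.normal_mul, ← hLa, ← Subgroup.map_sup, hK.sup_eq_top,
          Subgroup.map_top_of_surjective (a : R →* R) a.surjective]
        rfl
    obtain ⟨h, hh, hhK⟩ := hK.exists_conj_eq hcomm inferInstance hco' hKa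
    -- The conjugates of K by g and by h ∈ L agree, so h⁻¹g normalizes K.
    have key : (h : G)⁻¹ * g ∈ Subgroup.normalizer (K.map R.subtype : Set G) := by
      rw [Subgroup.mem_normalizer_iff_map_conj_eq]
      have e1 : (K.map R.subtype).map (MulAut.conj g : G →* G) =
          (K.map R.subtype).map (MulAut.conj (h : G) : G →* G) := by
        have e2 : (K.map (a : R →* R)).map R.subtype =
          (K.map (MulAut.conj h : R →* R)).map R.subtype := by rw [hhK]
        rw [Subgroup.map_map, Subgroup.map_map] at e2 ⊢
        exact e2
      have e3 : (MulAut.conj ((h : G)⁻¹ * g) : G →* G) =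
          ((MulAut.conj (h : G)⁻¹ : G →* G)).comp (MulAut.conj g : G →* G) := by
        ext x; simp
      rw [e3, ← Subgroup.map_map, e1, Subgroup.map_map]
      convert Subgroup.map_id _
      ext x; simp [mul_assoc]
    have : g = (h : G) * ((h : G)⁻¹ * g) := by group
    rw [this, sup_comm]
    exact Subgroup.mul_mem_sup hh key

/-- A normal `p`-subgroup `C` of `G` without proper supplements has a normal complement in every
normal subgroup in which its index is coprime to `p`. -/
theorem exists_normal_complement {p : ℕ} [hp : Fact p.Prime] :
    ∀ (n : ℕ) (G : Type u) [Group G] [Finite G], Nat.card G = n → ∀ C R : Subgroup G, C.Normal →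
      R.Normal → IsPGroup p C → (∀ M : Subgroup G, M ⊔ C = ⊤ → M = ⊤) → C ≤ R →
      Nat.Coprime p (C.relIndex R) → ∃ K : Subgroup G, K.Normal ∧ K ⊓ C = ⊥ ∧ K ⊔ C = R := by
  intro n
  induction n using Nat.strong_induction_on with
  | _ n ih =>
  intro G _ _ hn C R hC hR hCp hfr hCR hco
  by_cases hC0 : C = ⊥
  · subst hC0; exact ⟨R, hR, by simp, by simp⟩
  obtain ⟨L, hL, hLC⟩ := exists_isChiefFactor (inferInstance : (⊥ : Subgroup G).Normal) hC
    (bot_lt_iff_ne_bot.2 hC0)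
  have hLn := hL.normal_top
  have hLp : IsPGroup p L := hCp.to_le hLC
  have hLab := hL.commutator_eq_bot_of_isNilpotent hLn hLp.isNilpotent
  have hs := QuotientGroup.mk'_surjective L
  have hker := QuotientGroup.ker_mk' L
  have hlt : Nat.card (G ⧸ L) < n := by
    have h1 := L.card_eq_card_quotient_mul_card_subgroup
    have h2 : 1 < Nat.card L := (Subgroup.one_lt_card_iff_ne_bot _).2 hL.lt.ne'
    rw [← hn, h1]
    exact lt_mul_of_one_lt_right Nat.card_pos h2
  -- A supplement of C / L in G / L pulls back to a supplement of C in G, so the hypothesis on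
  -- supplements passes to the quotient.
  obtain ⟨K', hK'n, hK'1, hK'2⟩ := ih _ hlt (G ⧸ L) rfl (C.map (QuotientGroup.mk' L))
    (R.map (QuotientGroup.mk' L)) (hC.map _ hs) (hR.map _ hs) (hCp.map _)
    (fun M hM => by
      have h1 : M.comap (QuotientGroup.mk' L) ⊔ C = ⊤ := by
        rw [← Subgroup.comap_top (QuotientGroup.mk' L), ← hM, ← Subgroup.comap_sup_eq _ _ _ hs,
          Subgroup.comap_map_eq_self (hker.le.trans hLC)]
      rw [← Subgroup.map_comap_eq_self_of_surjective hs M, hfr _ h1,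
        Subgroup.map_top_of_surjective _ hs])
    (Subgroup.map_mono hCR)
    (by rwa [Subgroup.relIndex_map_of_ker_le _ (hker.le.trans hLC)])
  set K₁ := K'.comap (QuotientGroup.mk' L) with hK₁
  have hK₁n : K₁.Normal := hK'n.comap _
  have hLK₁ : L ≤ K₁ := hker.ge.trans (Subgroup.comap_mono bot_le)
  have h1 : K₁ ⊓ C = L := by
    rw [← Subgroup.comap_map_eq_self (hker.le.trans hLC), hK₁, ← Subgroup.comap_inf, hK'1]
    exact hker
  have h2 : K₁ ⊔ C = R := by
    rw [← Subgroup.comap_map_eq_self (hker.le.trans (hLC.trans hCR)), ← hK'2,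
      ← Subgroup.comap_sup_eq _ _ _ hs, Subgroup.comap_map_eq_self (hker.le.trans hLC)]
  have h3 : L.relIndex K₁ = C.relIndex R := by
    rw [← h2, Subgroup.relIndex_sup_right, ← Subgroup.inf_relIndex_right C, inf_comm C, h1]
  obtain ⟨K, hK1, hK2, hK3⟩ := exists_complement_normalizer_sup_eq_top hLn hLab hK₁n hLK₁ (by
    obtain ⟨k, hk⟩ := (IsPGroup.iff_card).1 hLp
    rw [hk, h3]
    exact hco.pow_left k)
  -- The normalizer supplements L ≤ C, hence C, and therefore is everything.
  have hN : Subgroup.normalizer (K : Set G) = ⊤ :=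
    hfr _ (eq_top_iff.2 (hK3.symm.le.trans (sup_le_sup_left hLC _)))
  refine ⟨K, Subgroup.normalizer_eq_top_iff.1 hN, ?_, ?_⟩
  · have hKK : K ≤ K₁ := hK2 ▸ le_sup_left
    have h4 : K ⊓ C ≤ L := h1 ▸ inf_le_inf_right _ hKK
    exact eq_bot_iff.2 (hK1 ▸ le_inf inf_le_left h4)
  · rw [← h2, ← hK2, sup_assoc, sup_eq_right.2 hLC]

end Complements

/-! ### π-nilpotence from centralized chief factors. -/

namespace GroupClass

/-- If a normal subgroup `D` centralizes all chief factors below it of order divisible by a prime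
in `π`, then `D` is `π`-nilpotent. -/
theorem exists_piGroup_nilpotent_quotient {π : Set Nat.Primes} :
    ∀ (n : ℕ) (G : Type u) [Group G] [Finite G], Nat.card G = n → ∀ D : Subgroup G, D.Normal →
      CentralizesPiFactors π D ⊥ D → ∃ K : Subgroup G, K.Normal ∧ K ≤ D ∧
        (piGroups πᶜ).Mem K ∧ ∃ m, D.lowerCentralSeries m ≤ K := by
  intro n
  induction n using Nat.strong_induction_on with
  | _ n ih =>
  intro G _ _ hn D hD hcent
  by_cases hD0 : D = ⊥
  · subst hD0
    refine ⟨⊥, inferInstance, le_rfl, ⟨inferInstance, fun p hp =>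
      absurd hp (by simpa using p.2.one_lt.ne')⟩, 0, le_rfl⟩
  obtain ⟨L, hL, hLD⟩ := exists_isChiefFactor (inferInstance : (⊥ : Subgroup G).Normal) hD
    (bot_lt_iff_ne_bot.2 hD0)
  have hLn := hL.normal_top
  have hs := QuotientGroup.mk'_surjective L
  have hker := QuotientGroup.ker_mk' L
  have hlt : Nat.card (G ⧸ L) < n := by
    have h1 := L.card_eq_card_quotient_mul_card_subgroup
    have h2 : 1 < Nat.card L := (Subgroup.one_lt_card_iff_ne_bot _).2 hL.lt.ne'
    rw [← hn, h1]
    exact lt_mul_of_one_lt_right Nat.card_pos h2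
  obtain ⟨R', hR'n, hR'D, hR'π, hR'nil⟩ := ih _ hlt (G ⧸ L) rfl (D.map (QuotientGroup.mk' L))
    (hD.map _ hs) ((hcent.mono bot_le le_rfl).map hs (hker.le.trans hLD))
  set R := R'.comap (QuotientGroup.mk' L) with hR
  have hRn : R.Normal := hR'n.comap _
  have hLR : L ≤ R := hker.ge.trans (Subgroup.comap_mono bot_le)
  have hRD : R ≤ D := by
    rw [← Subgroup.comap_map_eq_self (hker.le.trans hLD)]
    exact Subgroup.comap_mono hR'D
  have hRmap : R.map (QuotientGroup.mk' L) = R' := Subgroup.map_comap_eq_self_of_surjective hs _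
  have hrel : L.relIndex R = Nat.card R' := by
    rw [← hRmap, ← Subgroup.relIndex_ker, hker]
  obtain ⟨m, hm⟩ := hR'nil
  have hDR : D.lowerCentralSeries m ≤ R := by
    rwa [← Subgroup.map_lowerCentralSeries, Subgroup.map_le_iff_le_comap] at hm
  by_cases hp : ∃ p ∈ π, (p : ℕ) ∣ Nat.card L
  · obtain ⟨p, hpπ, hp⟩ := hp
    have : Fact (p : ℕ).Prime := ⟨p.2⟩
    have hDL : ⁅D, L⁆ = ⊥ := eq_bot_iff.2 <|
      hcent ⊥ L hL le_rfl hLD ⟨p, hpπ, by rwa [Subgroup.relIndex_bot_left]⟩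
    have hLab : ⁅L, L⁆ = ⊥ := eq_bot_iff.2 (hDL ▸ Subgroup.commutator_mono hLD le_rfl)
    have hLp := hL.isPGroup_of_commutator_self hp hLab
    obtain ⟨K, hK1, hK2, hK3⟩ := exists_complement_normalizer_sup_eq_top hLn hLab hRn hLR (by
      obtain ⟨k, hk⟩ := (IsPGroup.iff_card).1 hLp
      rw [hk, hrel]
      exact ((Nat.Prime.coprime_iff_not_dvd p.2).2 fun h => hR'π.2 p h hpπ).pow_left k)
    have hKR : K ≤ R := hK2 ▸ le_sup_left
    have hLK : L ≤ Subgroup.normalizer (K : Set G) := by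
      refine le_trans ?_ (Subgroup.centralizer_le_normalizer _)
      rw [← Subgroup.commutator_eq_bot_iff_le_centralizer, Subgroup.commutator_comm, eq_bot_iff,
        ← hDL]
      exact Subgroup.commutator_mono (hKR.trans hRD) le_rfl
    -- L is centralized by D ≥ K, so it normalizes K and adds nothing to the normalizer in the
    -- Frattini argument.
    have hKn : K.Normal := by
      rw [sup_eq_left.2 hLK] at hK3
      exact Subgroup.normalizer_eq_top_iff.1 hK3
    refine ⟨K, hKn, hKR.trans hRD, ?_, ?_⟩
    · have : Nat.card K = Nat.card R' := by
        rw [← hrel, ← hK2, Subgroup.relIndex_sup_right, ← Subgroup.inf_relIndex_right, inf_comm,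
          hK1, Subgroup.relIndex_bot_left]
      exact piGroups_mem_of_card_dvd this.dvd hR'π
    · refine ⟨m + 1, ?_⟩
      rw [Subgroup.lowerCentralSeries_succ, Subgroup.commutator_comm]
      refine (Subgroup.commutator_mono le_rfl (hDR.trans hK2.ge)).trans ?_
      exact commutator_sup_le hKn (Subgroup.commutator_le_right _ _) (hDL.le.trans bot_le)
  · refine ⟨R, hRn, hRD, ⟨inferInstance, fun p hpR hpπ => ?_⟩, m, hDR⟩
    rw [← Subgroup.relIndex_bot_left, ← Subgroup.relIndex_mul_relIndex ⊥ L R bot_le hLR,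
      Subgroup.relIndex_bot_left, hrel] at hpR
    rcases p.2.dvd_mul.1 hpR with h | h
    · exact hp ⟨p, hpπ, h⟩
    · exact hR'π.2 p h hpπ

end GroupClass

namespace GroupClass

/-! ### The minimal counterexample: general properties. -/

section MinimalConfiguration

open scoped commutatorElement

variable {π : Set Nat.Primes} {F : GroupClass.{u}} {G : Type u} [Group G] {L : Subgroup G}

/-- The properties of a minimal normal subgroup `L` of a smallest group whose norm is not
hypercentral. -/
structure IsMinimalConfiguration (π : Set Nat.Primes) (F : GroupClass.{u}) {G : Type u} [Group G]
    (L : Subgroup G) : Prop where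
  chief : IsChiefFactor ⊥ L
  le_of_normal : ∀ X : Subgroup G, X.Normal → X ≠ ⊥ → L ≤ X
  exists_dvd : ∃ p ∈ π, (p : ℕ) ∣ Nat.card L
  commutator_ne_bot : ⁅F.residual G, L⁆ ≠ ⊥
  le_normalizer : ∀ H : Subgroup G, L ≤ Subgroup.normalizer (F.subgroupResidual H : Set G)
  centralizes : ∀ M : Subgroup G, M ≠ ⊤ → L ≤ M →
    CentralizesPiFactors π (F.residual M) ⊥ (L.subgroupOf M)

theorem IsFormation.residual_le_sup (hF : F.IsFormation) [Finite G] {M N : Subgroup G}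
    (hN : N.Normal) (h : M ⊔ N = ⊤) : F.residual G ≤ F.subgroupResidual M ⊔ N := by
  have hs := QuotientGroup.mk'_surjective N
  have h1 : M.map (QuotientGroup.mk' N) = ⊤ := by
    rw [← Subgroup.map_top_of_surjective _ hs, ← h, Subgroup.map_sup, QuotientGroup.map_mk'_self,
      sup_bot_eq]
  have h2 : (F.residual G).map (QuotientGroup.mk' N) ≤
      (F.subgroupResidual M).map (QuotientGroup.mk' N) := by
    rw [hF.map_residual hs, hF.map_subgroupResidual, h1, hF.subgroupResidual_top]
  rwa [Subgroup.map_le_map_iff, QuotientGroup.ker_mk'] at h2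

theorem piGroups_mem_map_subtype [Finite G] {σ : Set Nat.Primes} {M : Subgroup G} {X : Subgroup M} :
    (piGroups σ).Mem (X.map M.subtype) ↔ (piGroups σ).Mem X :=
  let e := X.equivMapOfInjective M.subtype M.subtype_injective
  ⟨(piGroups σ).iso e.symm, (piGroups σ).iso e⟩

/-- A minimal normal subgroup `L` of `G` is a `σ`-group if some overgroup of `L` has a nontrivial
normal `σ`-subgroup inside `L`. -/
theorem piGroups_mem_of_normal_subgroupOf [Finite G] {σ : Set Nat.Primes} (hL : IsChiefFactor ⊥ L)
    {M : Subgroup G} (hLM : L ≤ M) {X : Subgroup M} (hX : X.Normal) (hXL : X ≤ L.subgroupOf M)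
    (hX0 : X ≠ ⊥) (h : (piGroups σ).Mem X) : (piGroups σ).Mem L := by
  refine hL.piGroups_mem_of_normal (X := X.map M.subtype) ?_ ?_ ?_
    (piGroups_mem_map_subtype.2 h)
  · rwa [Subgroup.map_le_iff_le_comap]
  · rwa [Ne, Subgroup.map_eq_bot_iff_of_injective _ M.subtype_injective]
  · refine ⟨?_⟩
    rintro n ⟨x, hx, hxn⟩ g
    refine ⟨⟨g, hLM g.2⟩ * x * ⟨g, hLM g.2⟩⁻¹, hX.conj_mem _ hx _, ?_⟩
    rw [map_mul, map_mul, hxn]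
    rfl

/-- The residual of M is normalized by M and by L, hence normal in G. It lies in M, so it does not
contain L, and uniqueness of L forces it to be trivial. -/
theorem IsMinimalConfiguration.subgroupResidual_eq_bot (h : IsMinimalConfiguration π F L)
    (hF : F.IsFormation) [Finite G] {M : Subgroup G} (hLM : ¬ L ≤ M) (hM : M ⊔ L = ⊤) :
    F.subgroupResidual M = ⊥ := by
  by_contra h0
  refine hLM ((h.le_of_normal _ ?_ h0).trans (subgroupResidual_le M))
  rw [← Subgroup.normalizer_eq_top_iff, eq_top_iff, ← hM]
  exact sup_le (Subgroup.le_normalizer.trans (hF.normalizer_le_normalizer_subgroupResidual M))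
    (h.le_normalizer M)

theorem IsMinimalConfiguration.le_residual (h : IsMinimalConfiguration π F L) :
    L ≤ F.residual G :=
  h.le_of_normal _ inferInstance fun h0 => h.commutator_ne_bot (by rw [h0, Subgroup.commutator_bot_left])

/-! ### The minimal counterexample: L non-abelian. -/

section NonAbelian

theorem IsMinimalConfiguration.centralizer_eq_bot (h : IsMinimalConfiguration π F L)
    (hab : ⁅L, L⁆ ≠ ⊥) : Subgroup.centralizer (L : Set G) = ⊥ := by
  have := h.chief.normal_top
  by_contra h0
  exact hab (Subgroup.commutator_eq_bot_iff_le_centralizer.2 (h.le_of_normal _ inferInstance h0))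

theorem IsMinimalConfiguration.not_isPGroup (h : IsMinimalConfiguration π F L)
    (hab : ⁅L, L⁆ ≠ ⊥) [Finite G] (p : Nat.Primes) : ¬ (piGroups {p}).Mem L := by
  intro hp
  have : Fact (p : ℕ).Prime := ⟨p.2⟩
  exact hab (h.chief.commutator_self_of_isPGroup (piGroups_singleton_mem_iff.1 hp))

theorem IsMinimalConfiguration.not_piGroups_compl_mem (h : IsMinimalConfiguration π F L) :
    ¬ (piGroups πᶜ).Mem L := by
  obtain ⟨p, hp, hd⟩ := h.exists_dvd
  exact fun h' => h'.2 p hd hp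

/-- If the residual of M meets L trivially, it centralizes L, and L has trivial centralizer.
Otherwise the intersection contains a minimal normal subgroup X of M, which is a π'-group or is
centralized by the residual and so is an abelian p-group. As X is normal in L, the same would hold
for L. -/
theorem IsMinimalConfiguration.subgroupResidual_eq_bot_of_le (h : IsMinimalConfiguration π F L)
    (hab : ⁅L, L⁆ ≠ ⊥) [Finite G] {M : Subgroup G} (hM : M ≠ ⊤) (hLM : L ≤ M) :
    F.subgroupResidual M = ⊥ := by
  have hLn := h.chief.normal_top
  have hLn' : (L.subgroupOf M).Normal := inferInstance
  by_cases hE : F.residual M ⊓ L.subgroupOf M = ⊥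
  · rw [eq_bot_iff, ← h.centralizer_eq_bot hab, ← Subgroup.commutator_eq_bot_iff_le_centralizer]
    have h1 : ⁅F.residual M, L.subgroupOf M⁆ = ⊥ :=
      eq_bot_iff.2 (hE ▸ Subgroup.commutator_le_inf _ _)
    have h2 := congrArg (Subgroup.map M.subtype) h1
    rwa [Subgroup.map_commutator, Subgroup.map_bot, Subgroup.map_subgroupOf_eq_of_le hLM] at h2
  · exfalso
    obtain ⟨X, hX, hXE⟩ := exists_isChiefFactor (inferInstance : (⊥ : Subgroup M).Normal)
      (inferInstance : (F.residual M ⊓ L.subgroupOf M).Normal) (bot_lt_iff_ne_bot.2 hE)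
    by_cases hp : ∃ p ∈ π, (p : ℕ) ∣ Nat.card X
    · have h1 := h.centralizes M hM hLM ⊥ X hX le_rfl (hXE.trans inf_le_right)
        (by rwa [Subgroup.relIndex_bot_left])
      obtain ⟨p, hp, hd⟩ := hp
      have h2 : ⁅X, X⁆ = ⊥ := eq_bot_iff.2
        ((Subgroup.commutator_mono (hXE.trans inf_le_left) le_rfl).trans h1)
      exact h.not_isPGroup hab p (piGroups_mem_of_normal_subgroupOf h.chief hLM hX.normal_top
        (hXE.trans inf_le_right) hX.lt.ne'
        (piGroups_singleton_mem_iff.2 (hX.isPGroup_of_commutator_self hd h2)))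
    · exact h.not_piGroups_compl_mem (piGroups_mem_of_normal_subgroupOf h.chief hLM hX.normal_top
        (hXE.trans inf_le_right) hX.lt.ne' ⟨inferInstance, fun p hd hpπ => hp ⟨p, hpπ, hd⟩⟩)

theorem IsMinimalConfiguration.isCritical_of_commutator_ne_bot (h : IsMinimalConfiguration π F L)
    (hF : F.IsFormation) (hS : F.IsSubgroupClosed) [Finite G] (hab : ⁅L, L⁆ ≠ ⊥) :
    ∃ p ∈ π, ((piGroups {p}).prod F).IsCritical G ∧ ¬ ((piSolvableGroups π).prod F).Mem G := by
  obtain ⟨p, hp, -⟩ := h.exists_dvd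
  have hLn := h.chief.normal_top
  have hLD := h.le_residual
  have hL0 : L.subgroupOf (F.residual G) ≠ ⊥ := by
    rw [Ne, Subgroup.subgroupOf_eq_bot, disjoint_iff, inf_eq_left.2 hLD]
    exact h.chief.lt.ne'
  -- All proper subgroups turn out to lie in F itself, so any p ∈ π serves.
  refine ⟨p, hp, ⟨inferInstance, ?_, ?_⟩, ?_⟩
  · rintro ⟨-, hD⟩
    exact h.not_isPGroup hab p (piGroups_mem_of_card_dvd (Subgroup.card_dvd_of_le hLD) hD)
  · intro M hM
    refine ⟨inferInstance, ?_⟩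
    have h1 : F.subgroupResidual M = ⊥ := by
      by_cases hLM : L ≤ M
      · exact h.subgroupResidual_eq_bot_of_le hab hM.ne hLM
      · by_cases h2 : M ⊔ L = ⊤
        · exact h.subgroupResidual_eq_bot hF hLM h2
        · exact eq_bot_iff.2 (h.subgroupResidual_eq_bot_of_le hab h2 le_sup_right ▸
            hF.subgroupResidual_mono hS le_sup_left)
    rw [← piGroups_mem_map_subtype]
    change (piGroups {p}).Mem (F.subgroupResidual M)
    rw [h1]
    exact ⟨inferInstance, fun q hq => absurd hq (by simpa using q.2.one_lt.ne')⟩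
  · rintro ⟨-, -, hD⟩
    obtain ⟨X, hX, hXL⟩ := exists_isChiefFactor
      (inferInstance : (⊥ : Subgroup (F.residual G)).Normal)
      (inferInstance : (L.subgroupOf (F.residual G)).Normal) (bot_lt_iff_ne_bot.2 hL0)
    have hD' := hD ⊥ X hX
    rw [Subgroup.relIndex_bot_left] at hD'
    rcases hD' with ⟨q, -, n, hn⟩ | hD'
    · have : Fact (q : ℕ).Prime := ⟨q.2⟩
      exact h.not_isPGroup hab q (piGroups_mem_of_normal_subgroupOf h.chief hLD hX.normal_top
        hXL hX.lt.ne' (piGroups_singleton_mem_iff.2 (IsPGroup.iff_card.2 ⟨n, hn⟩)))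
    · exact h.not_piGroups_compl_mem (piGroups_mem_of_normal_subgroupOf h.chief hLD hX.normal_top
        hXL hX.lt.ne' ⟨inferInstance, fun q hq hqπ => hD' q hqπ hq⟩)

end NonAbelian

end MinimalConfiguration

end GroupClass

namespace GroupClass

/-! ### The minimal counterexample: L abelian. -/

section Abelian

open scoped commutatorElement

variable {π : Set Nat.Primes} {F : GroupClass.{u}} {G : Type u} [Group G] {L : Subgroup G}

theorem _root_.IsPGroup.dvd_relIndex_of_lt [Finite G] {p : ℕ} [hp : Fact p.Prime]
    {U L : Subgroup G} (hL : IsPGroup p L) (h : U < L) : p ∣ U.relIndex L := by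
  obtain ⟨k, hk⟩ := IsPGroup.iff_card.1 hL
  have h1 : U.relIndex L ∣ p ^ k := hk ▸ Subgroup.relIndex_dvd_card U L
  obtain ⟨j, -, hj⟩ := (Nat.dvd_prime_pow hp.out).1 h1
  rw [hj]
  refine dvd_pow_self p fun h0 => h.not_ge ?_
  rw [← Subgroup.relIndex_eq_one, hj, h0, pow_zero]

theorem _root_.IsPGroup.eq_one_of_coprime_orderOf {p : ℕ} [Fact p.Prime]
    (hG : IsPGroup p G) {x : G} (hx : Nat.Coprime (orderOf x) p) : x = 1 := by
  obtain ⟨k, hk⟩ := hG x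
  rw [← orderOf_eq_one_iff]
  exact (hx.pow_right k).eq_one_of_dvd (orderOf_dvd_of_pow_eq_one hk)

/-- Coprime action: a `p'`-element of a subgroup that centralizes all chief factors below a normal
`p`-subgroup `L` centralizes `L`. -/
theorem commute_of_coprime_orderOf [Finite G] {p : Nat.Primes} (hp : p ∈ π) {D : Subgroup G}
    (hLn : L.Normal) (hL : IsPGroup p L) (h : CentralizesPiFactors π D ⊥ L) {x : G} (hx : x ∈ D)
    (hxp : Nat.Coprime (orderOf x) p) : ∀ l ∈ L, Commute x l := by
  have : Fact (p : ℕ).Prime := ⟨p.2⟩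
  obtain ⟨U, hU⟩ := (Set.toFinite {U : Subgroup G | U.Normal ∧ U ≤ L ∧
    ∀ l ∈ U, Commute x l}).exists_maximal
    ⟨⊥, inferInstance, bot_le, fun l hl => by rw [Subgroup.mem_bot.1 hl]; exact Commute.one_right x⟩
  obtain ⟨hUn, hUL, hUx⟩ := hU.prop
  rcases hUL.eq_or_lt with rfl | hlt
  · exact hUx
  exfalso
  obtain ⟨Y, hY, hYL⟩ := exists_isChiefFactor hUn hLn hlt
  have hYp : IsPGroup p Y := hL.to_le hYL
  have hDY := h U Y hY bot_le hYL ⟨p, hp, hYp.dvd_relIndex_of_lt hY.lt⟩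
  -- With u = ⁅x, l⁆ ∈ U commuting with x, taking n to be the order of x in `hconj` gives uⁿ = 1 for
  -- n prime to p. As u lies in the p-group L, u = 1, so x centralizes Y, against the maximality of
  -- U.
  refine hY.lt.not_ge (hU.le_of_ge ⟨hY.normal_top, hYL, fun l hl => ?_⟩ hY.lt.le)
  have hu := hDY (Subgroup.commutator_mem_commutator hx hl)
  set u : G := ⁅x, l⁆ with hudef
  have hxu : Commute x u := hUx u hu
  have hconj : ∀ n : ℕ, x ^ n * l = u ^ n * l * x ^ n := by
    intro n
    induction n with
    | zero => simp
    | succ n ih =>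
      have e : x * l = u * l * x := by rw [hudef, commutatorElement_def]; group
      calc x ^ (n + 1) * l = x * (x ^ n * l) := by rw [pow_succ', mul_assoc]
        _ = x * u ^ n * l * x ^ n := by rw [ih]; simp only [mul_assoc]
        _ = u ^ n * (x * l) * x ^ n := by rw [(hxu.pow_right n).eq]; simp only [mul_assoc]
        _ = u ^ (n + 1) * l * x ^ (n + 1) := by
          rw [e, pow_succ, pow_succ']; simp only [mul_assoc]
  have h1 := hconj (orderOf x)
  rw [pow_orderOf_eq_one, one_mul, mul_one, eq_comm, mul_eq_right] at h1
  have hu1 : (⟨u, hUL hu⟩ : L) = 1 := hL.eq_one_of_coprime_orderOf (by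
    rw [Subgroup.orderOf_mk]
    exact Nat.Coprime.coprime_dvd_left (orderOf_dvd_of_pow_eq_one h1) hxp)
  have hu2 : ⁅x, l⁆ = 1 := congrArg Subtype.val hu1
  exact commutatorElement_eq_one_iff_commute.1 hu2

namespace IsMinimalConfiguration

variable (h : IsMinimalConfiguration π F L)

include h

/-- A proper supplement of L would have trivial residual, so the residual of G would lie in the
abelian group L and centralize it. -/
theorem sup_ne_top (hF : F.IsFormation) [Finite G] (hab : ⁅L, L⁆ = ⊥) {M : Subgroup G}
    (hM : M ≠ ⊤) : M ⊔ L ≠ ⊤ := by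
  intro hML
  by_cases hLM : L ≤ M
  · exact hM (by rwa [sup_eq_left.2 hLM] at hML)
  · have h1 := hF.residual_le_sup h.chief.normal_top hML
    rw [h.subgroupResidual_eq_bot hF hLM hML, bot_sup_eq] at h1
    exact h.commutator_ne_bot (eq_bot_iff.2 (hab ▸ Subgroup.commutator_mono h1 le_rfl))

/-- Suppose MC = G, where M may be enlarged to the proper subgroup ML. A minimal normal subgroup X
of ML inside L is centralized by the residual of ML and by C, hence by the residual of G. So the
centralizer of the latter is a nontrivial normal subgroup and contains L, a contradiction. -/
theorem sup_centralizer_ne_top (hF : F.IsFormation) [Finite G] (hab : ⁅L, L⁆ = ⊥)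
    {p : Nat.Primes} (hp : p ∈ π) (hLp : IsPGroup p L) {M : Subgroup G} (hM : M ≠ ⊤) :
    M ⊔ Subgroup.centralizer (L : Set G) ≠ ⊤ := by
  have : Fact (p : ℕ).Prime := ⟨p.2⟩
  have hLn := h.chief.normal_top
  have hLC : L ≤ Subgroup.centralizer (L : Set G) :=
    Subgroup.commutator_eq_bot_iff_le_centralizer.1 hab
  set C := Subgroup.centralizer (L : Set G) with hC
  have hM' := h.sup_ne_top hF hab hM
  intro hMC
  have hMC' : (M ⊔ L) ⊔ C = ⊤ := by rw [sup_assoc, sup_eq_right.2 hLC, hMC]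
  set M' := M ⊔ L
  have hLM' : L ≤ M' := le_sup_right
  have hL0 : L.subgroupOf M' ≠ ⊥ := by
    rw [Ne, Subgroup.subgroupOf_eq_bot, disjoint_iff, inf_eq_left.2 hLM']
    exact h.chief.lt.ne'
  obtain ⟨X, hX, hXL⟩ := exists_isChiefFactor (inferInstance : (⊥ : Subgroup M').Normal)
      (inferInstance : (L.subgroupOf M').Normal) (bot_lt_iff_ne_bot.2 hL0)
  have hXp : IsPGroup p X :=
    (hLp.comap_of_injective M'.subtype M'.subtype_injective).to_le hXL
  have h1 : ⁅F.residual M', X⁆ = ⊥ := eq_bot_iff.2 <| h.centralizes M' hM' hLM' ⊥ X hX le_rfl hXL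
    ⟨p, hp, hXp.dvd_relIndex_of_lt hX.lt⟩
  have hXL' : X.map M'.subtype ≤ L := Subgroup.map_le_iff_le_comap.2 hXL
  have h2 := congrArg (Subgroup.map M'.subtype) h1
  rw [Subgroup.map_commutator, Subgroup.map_bot, Subgroup.commutator_eq_bot_iff_le_centralizer]
    at h2
  have h3 : F.residual G ≤ Subgroup.centralizer (X.map M'.subtype : Set G) :=
    (hF.residual_le_sup inferInstance hMC').trans
      (sup_le h2 (Subgroup.centralizer_le hXL'))
  have h4 : X.map M'.subtype ≤ Subgroup.centralizer (F.residual G : Set G) := by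
    rwa [← Subgroup.commutator_eq_bot_iff_le_centralizer, Subgroup.commutator_comm,
      Subgroup.commutator_eq_bot_iff_le_centralizer]
  have h5 : L ≤ Subgroup.centralizer (F.residual G : Set G) := by
    refine h.le_of_normal _ inferInstance fun h0 => hX.lt.ne' ?_
    rw [h0, le_bot_iff, Subgroup.map_eq_bot_iff_of_injective _ M'.subtype_injective] at h4
    exact h4
  exact h.commutator_ne_bot (by
    rwa [Subgroup.commutator_comm, Subgroup.commutator_eq_bot_iff_le_centralizer])

/-- By the Frattini argument the normalizer of a Sylow q-subgroup of C supplements C, so it is G. A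
nontrivial Sylow q-subgroup is then normal in G and contains L, whence q = p. -/
theorem isPGroup_centralizer (hF : F.IsFormation) [Finite G] (hab : ⁅L, L⁆ = ⊥)
    {p : Nat.Primes} (hp : p ∈ π) (hLp : IsPGroup p L) :
    IsPGroup p (Subgroup.centralizer (L : Set G)) := by
  have hLn := h.chief.normal_top
  set C := Subgroup.centralizer (L : Set G) with hC
  rw [← piGroups_singleton_mem_iff]
  refine ⟨inferInstance, fun q hq => ?_⟩
  have : Fact (p : ℕ).Prime := ⟨p.2⟩
  have : Fact (q : ℕ).Prime := ⟨q.2⟩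
  obtain ⟨P⟩ : Nonempty (Sylow q C) := inferInstance
  have h1 := P.normalizer_sup_eq_top
  have h2 : Subgroup.normalizer ((P : Subgroup C).map C.subtype : Set G) = ⊤ := by
    by_contra hne
    exact h.sup_centralizer_ne_top hF hab hp hLp hne h1
  have h3 : L ≤ (P : Subgroup C).map C.subtype := by
    refine h.le_of_normal _ (Subgroup.normalizer_eq_top_iff.1 h2) ?_
    rw [Ne, Subgroup.map_eq_bot_iff_of_injective _ C.subtype_injective]
    exact P.ne_bot_of_dvd_card hq
  have h4 : IsPGroup q L := (P.isPGroup'.map C.subtype).to_le h3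
  have h5 : (piGroups {q}).Mem L := piGroups_singleton_mem_iff.2 h4
  have h6 : (p : ℕ) ∣ Nat.card L := by
    rw [← Subgroup.relIndex_bot_left]
    exact hLp.dvd_relIndex_of_lt h.chief.lt
  exact (h5.2 p h6).symm

/-- After enlarging M to ML, a p'-element of the residual centralizes L by coprime action, so it
lies in the p-group C and is trivial. -/
theorem piGroups_mem_subgroupResidual (hF : F.IsFormation) (hS : F.IsSubgroupClosed) [Finite G]
    (hab : ⁅L, L⁆ = ⊥) {p : Nat.Primes} (hp : p ∈ π) (hLp : IsPGroup p L) {M : Subgroup G}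
    (hM : M ≠ ⊤) : (piGroups {p}).Mem (F.subgroupResidual M) := by
  have : Fact (p : ℕ).Prime := ⟨p.2⟩
  have hLn := h.chief.normal_top
  refine piGroups_mem_of_card_dvd
    (Subgroup.card_dvd_of_le (hF.subgroupResidual_mono hS (le_sup_left : M ≤ M ⊔ L))) ?_
  have hM' := h.sup_ne_top hF hab hM
  set M' := M ⊔ L
  have hLM' : L ≤ M' := le_sup_right
  rw [subgroupResidual, piGroups_mem_map_subtype, piGroups_singleton_mem_iff]
  rintro ⟨y, hy⟩
  -- With the order of y written as pᵏm, p ∤ m, the power of y with exponent pᵏ is a p'-element.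
  obtain ⟨k, m, hm, hk⟩ := Nat.exists_eq_pow_mul_and_not_dvd (orderOf_pos y).ne' p p.2.ne_one
  refine ⟨k, Subtype.ext ?_⟩
  change y ^ (p : ℕ) ^ k = 1
  have hord : orderOf (y ^ (p : ℕ) ^ k) = m := by
    rw [orderOf_pow_of_dvd (pow_ne_zero _ p.2.ne_zero) (hk ▸ dvd_mul_right _ _), hk,
      Nat.mul_div_cancel_left _ (pow_pos p.2.pos k)]
  have hco : Nat.Coprime (orderOf (y ^ (p : ℕ) ^ k)) p := by
    rw [hord]; exact ((Nat.Prime.coprime_iff_not_dvd p.2).2 hm).symm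
  have hcomm := commute_of_coprime_orderOf hp (inferInstance : (L.subgroupOf M').Normal)
    (hLp.comap_of_injective M'.subtype M'.subtype_injective) (h.centralizes M' hM' hLM')
    (Subgroup.pow_mem _ hy ((p : ℕ) ^ k)) hco
  have hyC : ((y ^ (p : ℕ) ^ k : M') : G) ∈ Subgroup.centralizer (L : Set G) := by
    rw [Subgroup.mem_centralizer_iff]
    intro l hl
    exact (congrArg Subtype.val (hcomm ⟨l, hLM' hl⟩ hl).eq).symm
  have h1 := (h.isPGroup_centralizer hF hab hp hLp).eq_one_of_coprime_orderOf
    (x := ⟨_, hyC⟩) (by rwa [Subgroup.orderOf_mk, Subgroup.orderOf_coe])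
  have h2 := congrArg Subtype.val h1
  exact Subtype.ext h2

theorem le_centralizer_of_isPGroup [Finite G] {p : Nat.Primes} {Q : Subgroup G} (hQ : Q.Normal)
    (hQp : IsPGroup p Q) : Q ≤ Subgroup.centralizer (L : Set G) := by
  have : Fact (p : ℕ).Prime := ⟨p.2⟩
  exact Subgroup.commutator_eq_bot_iff_le_centralizer.1
    (h.chief.commutator_eq_bot_of_isNilpotent hQ hQp.isNilpotent)

theorem not_residual_le_centralizer : ¬ F.residual G ≤ Subgroup.centralizer (L : Set G) :=
  fun hle => h.commutator_ne_bot (Subgroup.commutator_eq_bot_iff_le_centralizer.2 hle)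

theorem not_piSolvable_residual (hF : F.IsFormation) [Finite G]
    (hab : ⁅L, L⁆ = ⊥) {p : Nat.Primes} (hp : p ∈ π) (hLp : IsPGroup p L) :
    ¬ (piSolvableGroups π).Mem (F.residual G) := by
  rintro ⟨-, hsol⟩
  have : Fact (p : ℕ).Prime := ⟨p.2⟩
  have hLn := h.chief.normal_top
  have hLC : L ≤ Subgroup.centralizer (L : Set G) :=
    Subgroup.commutator_eq_bot_iff_le_centralizer.1 hab
  have hCp := h.isPGroup_centralizer hF hab hp hLp
  have hDC := h.not_residual_le_centralizer
  have hfr : ∀ M : Subgroup G, M ⊔ Subgroup.centralizer (L : Set G) = ⊤ → M = ⊤ := by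
    intro M hM
    by_contra hne
    exact h.sup_centralizer_ne_top hF hab hp hLp hne hM
  have hQC : ∀ Q : Subgroup G, Q.Normal → IsPGroup p Q → Q ≤ Subgroup.centralizer (L : Set G) :=
    fun Q hQ hQp => h.le_centralizer_of_isPGroup hQ hQp
  have hCn : (Subgroup.centralizer (L : Set G)).Normal := inferInstance
  generalize Subgroup.centralizer (L : Set G) = C at *
  set D := F.residual G with hD
  have hDn : D.Normal := residual_normal
  -- Y / (C ∩ D) is a chief factor of D; π-solvability makes it a p-group or a p'-group.
  obtain ⟨Y, hY, -⟩ := exists_isChiefFactor (inferInstance : (C.subgroupOf D).Normal)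
    (inferInstance : (⊤ : Subgroup D).Normal)
    (lt_top_iff_ne_top.2 fun ht => hDC (Subgroup.subgroupOf_eq_top.1 ht))
  have hYn := hY.normal_top
  have hYC : ¬ Y.map D.subtype ≤ C := fun hle => hY.lt.not_ge (Subgroup.map_le_iff_le_comap.1 hle)
  have hYn' : ((Y.map D.subtype).subgroupOf D).Normal := by
    rwa [Subgroup.subgroupOf, Subgroup.comap_map_eq_self_of_injective D.subtype_injective]
  have hrel : (C.subgroupOf D).relIndex Y = C.relIndex (Y.map D.subtype) :=
    Subgroup.relIndex_comap _ _ _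
  -- If the factor is a p-group, so is Y. Then Y lies in a normal p-subgroup of G, which centralizes
  -- L, so Y ≤ C, a contradiction.
  by_cases hpd : (p : ℕ) ∣ (C.subgroupOf D).relIndex Y
  · have hpow : ∃ n : ℕ, (C.subgroupOf D).relIndex Y = (p : ℕ) ^ n := by
      rcases hsol _ _ hY with ⟨q, -, n, hn⟩ | h'
      · refine ⟨n, ?_⟩
        rw [hn] at hpd
        rw [hn, (Nat.prime_dvd_prime_iff_eq p.2 q.2).1 (p.2.dvd_of_dvd_pow hpd)]
      · exact absurd hpd (h' p hp)
    obtain ⟨n, hn⟩ := hpow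
    have hCDp : IsPGroup p (C.subgroupOf D) :=
      hCp.comap_of_injective D.subtype D.subtype_injective
    have hYp : IsPGroup p Y := by
      obtain ⟨k, hk⟩ := IsPGroup.iff_card.1 hCDp
      refine IsPGroup.iff_card.2 ⟨k + n, ?_⟩
      rw [← Subgroup.relIndex_bot_left,
        ← Subgroup.relIndex_mul_relIndex ⊥ (C.subgroupOf D) Y bot_le hY.lt.le,
        Subgroup.relIndex_bot_left, hk, hn, pow_add]
    obtain ⟨R, hR, hYR, -, hRp⟩ := exists_normal_piGroup_ge hDn (Subgroup.map_subtype_le Y) hYn'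
      (piGroups_singleton_mem_iff.2 (hYp.map D.subtype))
    exact hYC (hYR.trans (hQC R hR (piGroups_singleton_mem_iff.1 hRp)))
  -- If the factor is a p'-group, YC / C lies in a normal p'-subgroup of G / C. Its preimage has a
  -- normal complement K to C: either K = 1 and Y ≤ C, or L ≤ K ∩ C = 1.
  · have hs := QuotientGroup.mk'_surjective C
    have hker := QuotientGroup.ker_mk' C
    set f := QuotientGroup.mk' C
    have hYf : (((Y.map D.subtype).map f).subgroupOf (D.map f)).Normal := by
      refine ⟨?_⟩
      rintro ⟨_, d₁, hd₁, rfl⟩ ⟨_, ⟨y, hy, rfl⟩, hyd⟩ ⟨_, d, hd, rfl⟩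
      refine ⟨d * y * d⁻¹, ⟨⟨d, hd⟩ * y * ⟨d, hd⟩⁻¹, hYn.conj_mem _ hy _, rfl⟩, ?_⟩
      have hyd' : f y = f d₁ := hyd
      simp [hyd']
    have hYσ : (piGroups {p}ᶜ).Mem ((Y.map D.subtype).map f) := by
      refine ⟨inferInstance, fun q hq hqp => hpd ?_⟩
      rw [← Subgroup.relIndex_ker, hker, ← hrel] at hq
      rwa [Set.mem_singleton_iff.1 hqp] at hq
    obtain ⟨R, hR, hYR, -, hRσ⟩ := exists_normal_piGroup_ge (hDn.map f hs)
      (Subgroup.map_mono (Subgroup.map_subtype_le Y)) hYf hYσ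
    have hCR : C ≤ R.comap f := hker.ge.trans (Subgroup.comap_mono bot_le)
    have hco : Nat.Coprime p (C.relIndex (R.comap f)) := by
      have hRc := Subgroup.relIndex_ker (K := R.comap f) f
      rw [hker, Subgroup.map_comap_eq_self_of_surjective hs] at hRc
      rw [Nat.Prime.coprime_iff_not_dvd p.2, hRc]
      exact fun hd => hRσ.2 p hd rfl
    obtain ⟨K, hKn, hKC, hKR⟩ := exists_normal_complement _ G rfl C (R.comap f) hCn (hR.comap f)
      hCp hfr hCR hco
    by_cases hK0 : K = ⊥
    · rw [hK0, bot_sup_eq] at hKR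
      exact hYC ((Subgroup.map_le_iff_le_comap.1 hYR).trans hKR.ge)
    · exact h.chief.lt.not_ge (hKC ▸ le_inf (h.le_of_normal K hKn hK0) hLC)

theorem isCritical_of_commutator_eq_bot (hF : F.IsFormation) (hS : F.IsSubgroupClosed) [Finite G]
    (hab : ⁅L, L⁆ = ⊥) :
    ∃ p ∈ π, ((piGroups {p}).prod F).IsCritical G ∧ ¬ ((piSolvableGroups π).prod F).Mem G := by
  obtain ⟨p, hp, hd⟩ := h.exists_dvd
  have hLp := h.chief.isPGroup_of_commutator_self hd hab
  refine ⟨p, hp, ⟨inferInstance, ?_, fun M hM => ⟨inferInstance, ?_⟩⟩, ?_⟩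
  · rintro ⟨-, hD⟩
    exact h.not_residual_le_centralizer
      (h.le_centralizer_of_isPGroup residual_normal (piGroups_singleton_mem_iff.1 hD))
  · exact piGroups_mem_map_subtype.1 (h.piGroups_mem_subgroupResidual hF hS hab hp hLp hM.ne)
  · exact fun hsol => h.not_piSolvable_residual hF hab hp hLp hsol.2

theorem exists_isCritical (hF : F.IsFormation) (hS : F.IsSubgroupClosed) [Finite G] :
    ∃ p ∈ π, ((piGroups {p}).prod F).IsCritical G ∧ ¬ ((piSolvableGroups π).prod F).Mem G := by
  by_cases hab : ⁅L, L⁆ = ⊥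
  · exact h.isCritical_of_commutator_eq_bot hF hS hab
  · exact h.isCritical_of_commutator_ne_bot hF hS hab

end IsMinimalConfiguration

end Abelian

end GroupClass

/-! ### Reduction to the minimal counterexample and conclusion. -/

namespace GroupClass

variable {π : Set Nat.Primes} {F : GroupClass.{u}}

theorem _root_.IsChiefFactor.centralizesPiFactors {G : Type u} [Group G] {D L : Subgroup G}
    (hL : IsChiefFactor ⊥ L) (h : (∃ p ∈ π, (p : ℕ) ∣ Nat.card L) → ⁅D, L⁆ = ⊥) :
    CentralizesPiFactors π D ⊥ L := by
  intro K X hKX _ hXL hp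
  rcases hL.eq_or_eq K hKX.normal_bot bot_le (hKX.lt.le.trans hXL) with rfl | rfl
  · rcases hL.eq_or_eq X hKX.normal_top bot_le hXL with rfl | rfl
    · exact absurd hKX.lt (lt_irrefl _)
    · rw [Subgroup.relIndex_bot_left] at hp
      exact (h hp).le
  · exact absurd hXL hKX.lt.not_ge

/-- A smallest group whose norm is not hypercentral has a minimal configuration. -/
theorem exists_isMinimalConfiguration (hF : F.IsFormation) {G : Type u} [Group G] [Finite G]
    (ih : ∀ (H : Type u) [Group H] [Finite H], Nat.card H < Nat.card G →
      CentralizesPiFactors π (F.residual H) ⊥ ((piGroups πᶜ).norm F H))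
    (hG : ¬ CentralizesPiFactors π (F.residual G) ⊥ ((piGroups πᶜ).norm F G)) :
    ∃ L : Subgroup G, IsMinimalConfiguration π F L := by
  -- Proper quotients satisfy the claim, so trouble can only come from factors not lying above a
  -- nontrivial normal subgroup.
  have hquot : ∀ X : Subgroup G, X.Normal → X ≠ ⊥ →
      CentralizesPiFactors π (F.residual G) X ((piGroups πᶜ).norm F G ⊔ X) := by
    intro X hX hX0
    have hlt : Nat.card (G ⧸ X) < Nat.card G := by
      rw [X.card_eq_card_quotient_mul_card_subgroup]
      exact lt_mul_of_one_lt_right Nat.card_pos ((Subgroup.one_lt_card_iff_ne_bot _).2 hX0)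
    have hs := QuotientGroup.mk'_surjective X
    have h1 := ih (G ⧸ X) hlt
    rw [← hF.map_residual hs] at h1
    have h2 := h1.comap hs
    rw [QuotientGroup.ker_mk'] at h2
    refine h2.mono le_rfl (sup_le ?_ ?_)
    · exact Subgroup.map_le_iff_le_comap.1 (map_norm_le hF hs)
    · exact (QuotientGroup.ker_mk' X).ge.trans (Subgroup.comap_mono bot_le)
  have htop : (⊥ : Subgroup G) < ⊤ := by
    refine bot_lt_iff_ne_bot.2 fun h => hG fun K X hKX _ _ _ => ?_
    exact absurd ((le_top.trans h.le).trans bot_le) hKX.lt.not_ge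
  obtain ⟨L, hL, -⟩ := exists_isChiefFactor inferInstance inferInstance htop
  have hLn := hL.normal_top
  have hLq := hquot L hLn hL.lt.ne'
  have hLc : (∃ p ∈ π, (p : ℕ) ∣ Nat.card L) ∧ ⁅F.residual G, L⁆ ≠ ⊥ := by
    by_contra hcon
    rw [not_and_not_right] at hcon
    exact hG (((hL.centralizesPiFactors hcon).trans hLn hLq le_sup_right).mono le_rfl le_sup_left)
  -- Otherwise L meets the norm trivially, and every chief factor below the norm is isomorphic to
  -- one above L.
  have hLN : L ≤ (piGroups πᶜ).norm F G := by
    by_contra hcon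
    refine hG fun K X hKX _ hX hp => ?_
    have hK := hKX.normal_bot
    have hXn := hKX.normal_top
    have h0 : L ⊓ (piGroups πᶜ).norm F G = ⊥ :=
      (hL.eq_or_eq _ inferInstance bot_le inf_le_left).resolve_right
        fun h => hcon (inf_eq_left.1 h)
    have h1 : X ⊓ (K ⊔ L) ≤ K := by
      rw [sup_comm, inf_sup_eq_of_le_of_normal hK hKX.lt.le]
      refine sup_le ((le_inf inf_le_right (inf_le_left.trans hX)).trans (h0.le.trans bot_le)) le_rfl
    have h2 := hLq _ _ (hKX.sup hLn h1) le_sup_right (sup_le_sup_right hX _)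
      (by rwa [hKX.relIndex_sup hLn h1])
    exact (le_inf (Subgroup.commutator_le_right _ _)
      ((Subgroup.commutator_mono le_rfl le_sup_left).trans h2)).trans h1
  -- If L ∩ X = 1, then L is isomorphic to the chief factor LX / X, which the residual centralizes.
  have hmin : ∀ X : Subgroup G, X.Normal → X ≠ ⊥ → L ≤ X := by
    intro X hX hX0
    by_contra hcon
    have h0 : L ⊓ X = ⊥ := (hL.eq_or_eq _ inferInstance bot_le inf_le_left).resolve_right
      fun h => hcon (inf_eq_left.1 h)
    have h1 : L ⊓ (⊥ ⊔ X) ≤ ⊥ := by rw [bot_sup_eq, h0]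
    have h2 := hquot X hX hX0 _ _ (hL.sup hX h1) le_sup_right (sup_le_sup_right hLN _)
      (by rw [hL.relIndex_sup hX h1, Subgroup.relIndex_bot_left]; exact hLc.1)
    rw [bot_sup_eq] at h2
    exact hLc.2 (eq_bot_iff.2 (h0 ▸ le_inf (Subgroup.commutator_le_right _ _)
      ((Subgroup.commutator_mono le_rfl le_sup_left).trans h2)))
  have hrad : (piGroups πᶜ).radical G = ⊥ := by
    by_contra hcon
    obtain ⟨p, hp, hd⟩ := hLc.1
    exact piGroups_mem_radical.2 p
      (hd.trans (Subgroup.card_dvd_of_le (hmin _ inferInstance hcon))) hp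
  refine ⟨L, hL, hmin, hLc.1, hLc.2,
    fun H x hx => mem_normalizer_subgroupResidual hrad (hLN hx) H, fun M hM hLM => ?_⟩
  have hlt : Nat.card M < Nat.card G :=
    lt_of_le_of_ne (Subgroup.card_le_card_group M) fun h => hM (Subgroup.eq_top_of_card_eq M h)
  exact (ih M hlt).mono le_rfl
    ((Subgroup.comap_mono hLN).trans (subgroupOf_norm_le hF hrad M))

theorem centralizesPiFactors_norm (hF : F.IsFormation) (hS : F.IsSubgroupClosed)
    (hcrit : ∀ (G : Type u) [Group G] [Finite G],
      (∃ p ∈ π, ((piGroups {p}).prod F).IsCritical G ∧ ¬ ((piSolvableGroups π).prod F).Mem G) →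
      F.NormEqHypercentre π G) :
    ∀ (n : ℕ) (G : Type u) [Group G] [Finite G], Nat.card G = n →
      CentralizesPiFactors π (F.residual G) ⊥ ((piGroups πᶜ).norm F G) := by
  intro n
  induction n using Nat.strong_induction_on with
  | _ n ih =>
  intro G _ _ hn
  by_contra hcon
  obtain ⟨L, hL⟩ := exists_isMinimalConfiguration hF
    (fun H _ _ hH => ih _ (hn ▸ hH) H rfl) hcon
  exact hcon ((hcrit G (hL.exists_isCritical hF hS)).centralizesPiFactors_norm hF)

theorem normEqHypercentre_of_critical (hF : F.IsFormation) (hS : F.IsSubgroupClosed)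
    (hcrit : ∀ (G : Type u) [Group G] [Finite G],
      (∃ p ∈ π, ((piGroups {p}).prod F).IsCritical G ∧ ¬ ((piSolvableGroups π).prod F).Mem G) →
      F.NormEqHypercentre π G) (G : Type u) [Group G] [Finite G] : F.NormEqHypercentre π G :=
  normEqHypercentre_of_quotients hF hS
    fun N _ => centralizesPiFactors_norm hF hS hcrit _ (G ⧸ N) rfl

/-- The residuals of subgroups are trivial, except that of G, so all of them are normal. -/
theorem norm_eq_top_of_isCritical (hF : F.IsFormation) {X : GroupClass.{u}} {G : Type u} [Group G]
    (h : F.IsCritical G) : X.norm F G = ⊤ := by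
  have := h.1
  rw [eq_top_iff]
  intro x _
  rw [mem_norm_iff]
  intro H
  have hn : (F.subgroupResidual H).Normal := by
    rcases eq_or_ne H ⊤ with rfl | hH
    · rw [hF.subgroupResidual_top]; infer_instance
    · rw [(hF.subgroupResidual_eq_bot_iff H).2 (h.2.2 H (lt_top_iff_ne_top.2 hH))]
      infer_instance
  rw [Subgroup.normalizer_eq_top]
  trivial

theorem piNilpotentGroups_mem {G : Type u} [Group G] [Finite G] {D : Subgroup G} (hD : D.Normal)
    (h : CentralizesPiFactors π D ⊥ D) : (piNilpotentGroups π).Mem D := by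
  obtain ⟨K, hK, hKD, hKπ, m, hm⟩ := exists_piGroup_nilpotent_quotient _ G rfl D hD h
  refine ⟨inferInstance, K.subgroupOf D, inferInstance,
    (piGroups πᶜ).iso (Subgroup.subgroupOfEquivOfLe hKD).symm hKπ, ?_⟩
  rw [Subgroup.nilpotent_iff_lowerCentralSeries]
  refine ⟨m, ?_⟩
  rw [← Subgroup.map_top_of_surjective _ (QuotientGroup.mk'_surjective (K.subgroupOf D)),
    ← Subgroup.map_lowerCentralSeries, Subgroup.map_eq_bot_iff, QuotientGroup.ker_mk',
    Subgroup.subgroupOf, ← Subgroup.map_le_iff_le_comap, Subgroup.top_subtype_lowerCentralSeries]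
  exact hm

end GroupClass

theorem theoremB (π : Set Nat.Primes) (F : GroupClass.{u}) (hF : F.IsFormation)
    (hS : F.IsSubgroupClosed) :
    (F.BoundaryConditionII π → ∀ (G : Type u) [Group G] [Finite G], F.NormEqHypercentre π G) ∧
    ((∀ (G : Type u) [Group G] [Finite G], F.NormEqHypercentre π G) → F.BoundaryConditionI π) ∧
    ((∀ (G : Type u) [Group G] [Finite G], F.NormEqHypercentre π G) ↔
      ∀ (G : Type u) [Group G] [Finite G],
        (∃ p ∈ π, ((GroupClass.piGroups {p}).prod F).IsCritical G ∧
          ¬ ((GroupClass.piSolvableGroups π).prod F).Mem G) →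
        F.NormEqHypercentre π G) := by
  refine ⟨fun hII => ?_, fun h G _ hG => ?_, fun h G _ _ _ => h G, ?_⟩
  · refine GroupClass.normEqHypercentre_of_critical hF hS fun G _ _ hG => ?_
    obtain ⟨p, hp, hcrit, hns⟩ := hG
    exact absurd (hII p hp G hcrit) hns
  · have := hG.1
    have hc := (h G).centralizesPiFactors_norm hF
    rw [GroupClass.norm_eq_top_of_isCritical hF hG] at hc
    exact ⟨hG.1, GroupClass.piNilpotentGroups_mem inferInstance (hc.mono le_rfl le_top)⟩
  · exact fun h G _ _ => GroupClass.normEqHypercentre_of_critical hF hS h G
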